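/- A \emph{Mendelsohn quasigroup} is an idempotent quasigroup $(Q,\circ)$ satisfying $x\circ(y\circ x)=y$ for all $x,y\in Q$; it is \emph{distributive} if $x\circ(y\circ z)=(x\circ y)\circ(x\circ z)$ and $(x\circ y)\circ z=(x\circ z)\circ(y\circ z)$ for all $x,y,z\in Q$. A \emph{Mendelsohn triple system} of order $v$ is a set $V$ of $v$ points with a collection of cyclically ordered triples $\langle x,y,z\rangle$ of distinct points (such a triple contains the ordered pairs $(x,y)$, $(y,z)$, $(z,x)$) such that every ordered pair of distinct points is contained in exactly one of them; it is \emph{distributive} if the operation on $V$ given by $x\circ x=x$, and $x\circ y=z$ whenever $\langle x,y,z\rangle$ is one of the triples, is distributive. (1) Let $v=p_1^{r_1}\cdots p_a^{r_a}q_1^{s_1}\cdots q_b^{s_b}$, where $p_1,\dots,p_a,q_1,\dots,q_b$ are pairwise distinct primes, the exponents are non-negative integers, each $p_i\equiv 1\pmod 6$ or $p_i=3$, and each $q_j\equiv 2\pmod 3$. If some exponent $s_j$ is odd, then there is no distributive Mendelsohn quasigroup of order $v$. (2) For every integer $v\ge 1$, a distributive Mendelsohn quasigroup of order $v$ exists if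 and only if $v$ is a Loeschian number, that is, $v=x^2+xy+y^2$ for some integers $x,y\ge 0$. Likewise, for every integer $v\ge 1$, a distributive Mendelsohn triple system of order $v$ exists if and only if $v$ is a Loeschian number. -/

import Mathlib

universe u

/-- A binary operation is a quasigroup operation if all equations `a ∘ x = b` and `y ∘ a = b`
have a unique solution, i.e. all left and right translations are bijections. -/
structure IsQuasigroup {V : Type*} (op : V → V → V) : Prop where
  bijective_left : ∀ a, Function.Bijective (fun x => op a x)
  bijective_right : ∀ a, Function.Bijective (fun y => op y a)

/-- A Mendelsohn (semi-symmetric) quasigroup: an idempotent quasigroup with `x ∘ (y ∘ x) = y`. -/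
structure IsMendelsohnQuasigroup {V : Type*} (op : V → V → V) : Prop
    extends IsQuasigroup op where
  idem : ∀ x, op x x = x
  semisymm : ∀ x y, op x (op y x) = y

/-- Left and right distributivity of a binary operation. -/
structure IsDistributiveOp {V : Type*} (op : V → V → V) : Prop where
  left_distrib : ∀ x y z, op x (op y z) = op (op x y) (op x z)
  right_distrib : ∀ x y z, op (op x y) z = op (op x z) (op y z)

/-- A Mendelsohn triple system on the point set `V`: a collection of cyclically ordered triples
of distinct points, such that every ordered pair of distinct points is contained in exactly one
of them. The block `⟨x, y, z⟩` is the cycle of the list `[x, y, z]`; the ordered pairs contained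
in it are `(x, y)`, `(y, z)` and `(z, x)`, so `(x, y)` is contained in a block `C` exactly if
`C = ⟨x, y, z⟩` for some `z`. -/
structure MendelsohnTripleSystem (V : Type*) where
  blocks : Set (Cycle V)
  isTriple : ∀ C ∈ blocks, C.Nodup ∧ C.length = 3
  existsUnique_block : ∀ x y : V, x ≠ y →
    ∃! C : Cycle V, C ∈ blocks ∧ ∃ z : V, C = (([x, y, z] : List V) : Cycle V)

namespace MendelsohnTripleSystem

theorem exists_third {V : Type*} (M : MendelsohnTripleSystem V) {x y : V} (h : x ≠ y) :
    ∃ z : V, (([x, y, z] : List V) : Cycle V) ∈ M.blocks := by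
  obtain ⟨C, ⟨hC, z, rfl⟩, -⟩ := M.existsUnique_block x y h
  exact ⟨z, hC⟩

open Classical in
/-- The operation of the associated Mendelsohn quasigroup: `x ∘ x = x`, and `x ∘ y = z` if
`⟨x, y, z⟩` is a block. -/
noncomputable def op {V : Type*} (M : MendelsohnTripleSystem V) (x y : V) : V :=
  if h : x = y then x else (M.exists_third h).choose

theorem op_self {V : Type*} (M : MendelsohnTripleSystem V) (x : V) : M.op x x = x := by
  simp [op]

theorem op_eq_of_mem {V : Type*} (M : MendelsohnTripleSystem V) {x y z : V}
    (h : (([x, y, z] : List V) : Cycle V) ∈ M.blocks) : M.op x y = z := by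
  have hn := (M.isTriple _ h).1
  simp only [Cycle.nodup_coe_iff, List.nodup_cons, List.mem_cons, List.not_mem_nil] at hn
  have hxy : x ≠ y := by tauto
  have hxz : x ≠ z := by tauto
  have hyz : y ≠ z := by tauto
  have hs := (M.exists_third hxy).choose_spec
  have ho : M.op x y = (M.exists_third hxy).choose := by simp [op, hxy]
  rw [← ho] at hs
  have he := (M.existsUnique_block x y hxy).unique ⟨hs, _, rfl⟩ ⟨h, _, rfl⟩
  have hm : z ∈ (([x, y, M.op x y] : List V) : Cycle V) := by rw [he]; simp
  simp only [Cycle.mem_coe_iff, List.mem_cons, List.not_mem_nil] at hm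
  tauto

end MendelsohnTripleSystem

/-- Loeschian numbers: the numbers `x² + xy + y²` with `x, y ≥ 0`. -/
def IsLoeschian (n : ℕ) : Prop :=
  ∃ x y : ℕ, n = x ^ 2 + x * y + y ^ 2

/-!
Existence rests on the ring `ℤ[η]` of Eisenstein integers, `η ^ 2 = η - 1`, whose norm form is
`x ^ 2 + x * y + y ^ 2`. On an abelian group with an endomorphism `α` satisfying `α ^ 2 = α - 1` the
operation `a - α a + α b` is a distributive Mendelsohn quasigroup, and for every positive Loeschian
number there is such a group of that order (`IsLoeschian.exists_quasigroup`).

Conversely, a number is Loeschian as soon as all primes `q ≡ 2 [MOD 3]` have even exponents in it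
(`IsLoeschian.of_even_factorization`; Thue's lemma represents the primes `p ≡ 1 [MOD 3]`). So the
point is that these exponents are even in the order of a finite distributive Mendelsohn quasigroup
`Q` (`IsMendelsohnQuasigroup.even_factorization_card`). A Mendelsohn quasigroup of order `q ^ k` has
even `k`, because rotating the blocks `⟨x, y, x ∘ y⟩` is a permutation of `Q × Q` of order three
that fixes the diagonal only. To reduce to prime power order it is enough that the displacement group,
generated by the quotients of two left translations, is nilpotent: its Sylow `q`-subgroup is then
normal in the group generated by all left translations, hence its orbits are subquasigroups, and
their order is the `q`-part of the order of `Q`.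

Nilpotency of the displacement group (`IsMendelsohnQuasigroup.isNilpotent_displacement`) takes two
steps. By a variant of the Baer–Suzuki theorem (`Group.IsNilpotent.closure_of_pairs`), it suffices
that any two of the generators lie in a nilpotent subgroup. Two of them involve four points `x`,
`y`, `z`, `w`, and lie in a conjugate of the group generated by the displacements `z⁻¹ * x`,
`z⁻¹ * y`, `z⁻¹ * w`. This group is nilpotent of class at most four
(`IsDisplacementSet.isNilpotent_closure`). The proof uses only that the left translations form a
conjugation-invariant set with trivial centralizer in which any two elements satisfy the braid
relation (`IsBraidSet`). The commutator of two displacements from `z` is an automorphism fixing the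
three points involved (`IsBraidSet.commute_holonomy`), cubes of displacements commute with all
displacements (`IsBraidSet.commute_mul_conj_displacement`), and the cyclic symmetry of the
commutator gives a relation between the three commutators of `p`, `q`, `r`. These facts
(`IsDisplacementSet`) imply the required commutator identities.
-/

/-! ### Braid sets and their displacements -/

/-- A set of group elements that is closed under conjugation by its members, any two members of
which satisfy the braid relation, and whose centralizer in the ambient group is trivial. The left
translations of a distributive Mendelsohn quasigroup form such a set in the group they generate. -/
structure IsBraidSet {G : Type*} [Group G] (D : Set G) : Prop where
  conj_mem : ∀ {x y}, x ∈ D → y ∈ D → x * y * x⁻¹ ∈ D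
  braid : ∀ {x y}, x ∈ D → y ∈ D → x * y * x = y * x * y
  eq_one : ∀ g, (∀ x ∈ D, Commute g x) → g = 1

section Holonomy

open scoped commutatorElement

variable {G : Type*} [Group G]

/-- The commutator of the displacements `z⁻¹ * x` and `z⁻¹ * y`, conjugated into a form that is
invariant under cyclic shifts of the three points (see `IsBraidSet.commute_holonomy`). -/
def holonomy (x y z : G) : G := x * z⁻¹ * y * x⁻¹ * z * y⁻¹

namespace IsBraidSet

variable {D : Set G}

theorem conj_eq (hD : IsBraidSet D) {x y : G} (hx : x ∈ D) (hy : y ∈ D) :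
    x * y * x⁻¹ = y⁻¹ * x * y := by
  have h := hD.braid hx hy
  rw [mul_inv_eq_iff_eq_mul, mul_assoc, mul_assoc, eq_inv_mul_iff_mul_eq, ← mul_assoc, ← h,
    mul_assoc]

theorem inv_conj_mem (hD : IsBraidSet D) {x y : G} (hx : x ∈ D) (hy : y ∈ D) :
    x⁻¹ * y * x ∈ D := by
  rw [← hD.conj_eq hy hx]
  exact hD.conj_mem hy hx

theorem commute_holonomy_aux (hD : IsBraidSet D) {x y z : G} (hx : x ∈ D) (hy : y ∈ D)
    (hz : z ∈ D) : Commute (y⁻¹ * x * z⁻¹ * y * x⁻¹ * z) z := by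
  have h1 := hD.conj_eq (hD.conj_mem hx hy) hz
  have h2 := hD.conj_eq hx hz
  have h3 := hD.braid hy hz
  have key : (y⁻¹ * x * z⁻¹ * y * x⁻¹ * z) * z * (y⁻¹ * x * z⁻¹ * y * x⁻¹ * z)⁻¹ = z := by
    calc _ = y⁻¹ * (x * z * x⁻¹)⁻¹ * ((x * y * x⁻¹) * z * (x * y * x⁻¹)⁻¹) * (x * z * x⁻¹) * y := by
          group
      _ = y⁻¹ * z⁻¹ * (y * z * y) := by rw [h1, h2]; group
      _ = z := by rw [h3]; group
  exact mul_inv_eq_iff_eq_mul.mp key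

/-- The holonomy of three points fixes each of them: as an automorphism of the quasigroup it is
trivial on the subquasigroup they generate. -/
theorem commute_holonomy (hD : IsBraidSet D) {x y z : G} (hx : x ∈ D) (hy : y ∈ D)
    (hz : z ∈ D) : Commute (holonomy x y z) x ∧ Commute (holonomy x y z) y ∧
      Commute (holonomy x y z) z := by
  have hyz : ∀ {x y z : G}, x ∈ D → y ∈ D → z ∈ D →
      Commute (holonomy x y z) y ∧ Commute (holonomy x y z) z := by
    intro x y z hx hy hz
    have h1 := hD.commute_holonomy_aux hx hy hz
    have h2 : Commute (y⁻¹ * x * z⁻¹ * y * x⁻¹ * z) y := by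
      have := (hD.commute_holonomy_aux hx hz hy).inv_left
      rwa [show (z⁻¹ * x * y⁻¹ * z * x⁻¹ * y)⁻¹ = y⁻¹ * x * z⁻¹ * y * x⁻¹ * z by group] at this
    have h3 : holonomy x y z = y⁻¹ * x * z⁻¹ * y * x⁻¹ * z := by
      rw [show holonomy x y z = y * (y⁻¹ * x * z⁻¹ * y * x⁻¹ * z) * y⁻¹ by
        unfold holonomy; group, ← h2.eq]
      group
    rw [h3]
    exact ⟨h2, h1⟩
  refine ⟨?_, hyz hx hy hz⟩
  obtain ⟨h1, h2⟩ := hyz hy hz hx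
  have h3 : holonomy x y z = holonomy y z x := by
    rw [show holonomy x y z = (x * z⁻¹) * holonomy y z x * (x * z⁻¹)⁻¹ by
      unfold holonomy; group, ← (h2.mul_right h1.inv_right).eq]
    group
  rw [h3]
  exact h2

theorem holonomy_rotate (hD : IsBraidSet D) {x y z : G} (hx : x ∈ D) (hy : y ∈ D)
    (hz : z ∈ D) : holonomy y z x = holonomy x y z := by
  obtain ⟨-, h1, h2⟩ := hD.commute_holonomy hy hz hx
  rw [show holonomy x y z = (x * z⁻¹) * holonomy y z x * (x * z⁻¹)⁻¹ by
      unfold holonomy; group, ← (h2.mul_right h1.inv_right).eq]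
  group

theorem commutator_eq_holonomy (hD : IsBraidSet D) {x y z : G} (hx : x ∈ D) (hy : y ∈ D)
    (hz : z ∈ D) : ⁅z⁻¹ * x, z⁻¹ * y⁆ = holonomy x y z := by
  obtain ⟨-, -, h1⟩ := hD.commute_holonomy hx hy hz
  rw [show ⁅z⁻¹ * x, z⁻¹ * y⁆ = z⁻¹ * holonomy x y z * z by
    unfold holonomy; rw [commutatorElement_def]; group, mul_assoc, h1.eq]
  group

/-- Whether the holonomy of three points fixes a fourth one is a symmetric condition on the four
points. -/
theorem commute_holonomy_symm (hD : IsBraidSet D) {x y z w : G} (hx : x ∈ D) (hy : y ∈ D)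
    (hz : z ∈ D) (hw : w ∈ D) (h : Commute (holonomy x y z) w) :
    Commute (holonomy w y z) x := by
  have h1 : Commute (z * x⁻¹ * y * z⁻¹ * x * y⁻¹) w := by
    have := h.inv_left
    rwa [← hD.holonomy_rotate hx hy hz, show (holonomy y z x)⁻¹ = z * x⁻¹ * y * z⁻¹ * x * y⁻¹ by
      unfold holonomy; group] at this
  have e1 := hD.conj_eq (hD.conj_mem hw hy) (hD.conj_mem hz hx)
  have e2 := hD.conj_eq (hD.conj_mem hw hz) (hD.conj_mem hy hx)
  have e3 := hD.conj_eq hw hy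
  have e4 := hD.conj_eq hw hz
  have e5 := hD.conj_eq hz hx
  have e6 := hD.conj_eq hy hx
  have key : (w * y * w⁻¹) * (z * x * z⁻¹) * (w * y * w⁻¹)⁻¹ =
      (w * z * w⁻¹) * (y * x * y⁻¹) * (w * z * w⁻¹)⁻¹ := by
    rw [e1, e2, e3, e4, e5, e6]
    calc _ = x⁻¹ * y⁻¹ * x * z⁻¹ * ((z * x⁻¹ * y * z⁻¹ * x * y⁻¹) * w) *
          (z * x⁻¹ * y * z⁻¹ * x * y⁻¹)⁻¹ * z * x⁻¹ * y * x := by group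
      _ = _ := by rw [h1.eq]; group
  have h2 : Commute (y⁻¹ * w * z⁻¹ * y * w⁻¹ * z) x := by
    have : (y⁻¹ * w * z⁻¹ * y * w⁻¹ * z) * x * (y⁻¹ * w * z⁻¹ * y * w⁻¹ * z)⁻¹ = x := by
      calc _ = y⁻¹ * (w * z * w⁻¹)⁻¹ * ((w * y * w⁻¹) * (z * x * z⁻¹) * (w * y * w⁻¹)⁻¹) *
          (w * z * w⁻¹) * y := by group
        _ = x := by rw [key]; group
    exact mul_inv_eq_iff_eq_mul.mp this
  have h3 : holonomy w y z = y⁻¹ * w * z⁻¹ * y * w⁻¹ * z := by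
    obtain ⟨-, h4, -⟩ := hD.commute_holonomy hw hy hz
    rw [show y⁻¹ * w * z⁻¹ * y * w⁻¹ * z = y⁻¹ * holonomy w y z * y by unfold holonomy; group,
      mul_assoc, h4.eq]
    group
  rwa [h3]

/-- If every holonomy `holonomy x y z` fixes the point `u`, then the displacement of `u` from `z`
commutes with all displacements from `z`. -/
theorem commute_displacement (hD : IsBraidSet D) {u y z : G} (hu : u ∈ D) (hy : y ∈ D)
    (hz : z ∈ D) (h : ∀ x ∈ D, Commute (holonomy x y z) u) : Commute (z⁻¹ * u) (z⁻¹ * y) := by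
  have h1 : holonomy u y z = 1 :=
    hD.eq_one _ fun x hx => hD.commute_holonomy_symm hx hy hz hu (h x hx)
  rw [← hD.commutator_eq_holonomy hu hy hz] at h1
  exact commutatorElement_eq_one_iff_commute.mp h1

theorem braid_displacement (hD : IsBraidSet D) {x z : G} (hx : x ∈ D) (hz : z ∈ D) :
    x * z⁻¹ = (z⁻¹ * x) * (z * (x * z⁻¹) * z⁻¹) := by
  have h := hD.braid hx hz
  calc _ = z⁻¹ * (z * x * z) * z⁻¹ * z⁻¹ := by group
    _ = _ := by rw [← h]; group

theorem commute_displacement_conj (hD : IsBraidSet D) {x z : G} (hx : x ∈ D) (hz : z ∈ D) :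
    Commute (x * z⁻¹) (z⁻¹ * x) := by
  have := hD.commute_displacement (hD.conj_mem hz hx) hx hz fun s hs => by
    obtain ⟨-, h1, h2⟩ := hD.commute_holonomy hs hx hz
    exact (h2.mul_right h1).mul_right h2.inv_right
  rwa [show z⁻¹ * (z * x * z⁻¹) = x * z⁻¹ by group] at this

theorem conj_cube_displacement (hD : IsBraidSet D) {x z : G} (hx : x ∈ D) (hz : z ∈ D) :
    z * (z * (z * (z⁻¹ * x) * z⁻¹) * z⁻¹) * z⁻¹ = (z⁻¹ * x)⁻¹ := by
  have hc := (hD.commute_displacement_conj hx hz).eq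
  have h1 := hD.braid_displacement hx hz
  generalize hp : z⁻¹ * x = p at *
  have hp1 : x * z⁻¹ = z * p * z⁻¹ := by rw [← hp]; group
  rw [hp1] at hc h1
  have h2 : z * (z * p * z⁻¹) * z⁻¹ = p⁻¹ * (z * p * z⁻¹) := by
    rw [eq_inv_mul_iff_mul_eq]; exact h1.symm
  calc z * (z * (z * p * z⁻¹) * z⁻¹) * z⁻¹
      = (z * p * z⁻¹)⁻¹ * (z * (z * p * z⁻¹) * z⁻¹) := by
        conv_lhs => rw [h2]
        group
    _ = (z * p * z⁻¹)⁻¹ * p⁻¹ * (z * p * z⁻¹) := by rw [h2]; group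
    _ = (p * (z * p * z⁻¹))⁻¹ * (z * p * z⁻¹) := by group
    _ = p⁻¹ := by rw [← hc]; group

/-- The word expressing a holonomy with base point `w` through displacements from `z`. -/
theorem holonomy_eq_conj (hD : IsBraidSet D) {x y z w : G} (hx : x ∈ D) (hy : y ∈ D)
    (hz : z ∈ D) (hw : w ∈ D) :
    holonomy x y w = holonomy w x z * (z * (z⁻¹ * w)⁻¹ * holonomy x y z * (z * (z⁻¹ * w)⁻¹)⁻¹) *
      holonomy y w z := by
  obtain ⟨h1, -, h2⟩ := hD.commute_holonomy hw hx hz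
  obtain ⟨-, h3, h4⟩ := hD.commute_holonomy hy hw hz
  have h5 := (h2.mul_right (h2.inv_right.mul_right h1).inv_right).eq
  have h6 := (h4.mul_right (h4.inv_right.mul_right h3).inv_right).eq
  calc _ = z * (z⁻¹ * w)⁻¹ * (⁅z⁻¹ * w, z⁻¹ * x⁆ * ⁅z⁻¹ * x, z⁻¹ * y⁆ * ⁅z⁻¹ * y, z⁻¹ * w⁆) *
        (z * (z⁻¹ * w)⁻¹)⁻¹ := by
        simp only [holonomy, commutatorElement_def]; group
    _ = (z * (z⁻¹ * w)⁻¹ * holonomy w x z) * holonomy x y z *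
        (z * (z⁻¹ * w)⁻¹ * (holonomy y w z)⁻¹)⁻¹ := by
        rw [hD.commutator_eq_holonomy hw hx hz, hD.commutator_eq_holonomy hx hy hz,
          hD.commutator_eq_holonomy hy hw hz]; group
    _ = _ := by
        have h7 : z * (z⁻¹ * w)⁻¹ * (holonomy y w z)⁻¹ =
          (holonomy y w z)⁻¹ * (z * (z⁻¹ * w)⁻¹) := by
          rw [eq_inv_mul_iff_mul_eq, ← mul_assoc, h6]; group
        rw [h7, ← h5]; group

/-- Each holonomy based at `z` commutes with the element `(1 + α) r` of the displacement group,
where `r` is a displacement from `z` and `α` is conjugation by `z`. -/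
theorem commute_holonomy_mul_conj (hD : IsBraidSet D) {x y z w : G} (hx : x ∈ D) (hy : y ∈ D)
    (hz : z ∈ D) (hw : w ∈ D) : Commute (holonomy x y z) ((z⁻¹ * w) * (w * z⁻¹)) := by
  obtain ⟨-, -, hWz⟩ := hD.commute_holonomy hx hy hz
  obtain ⟨-, -, hk⟩ := hD.commute_holonomy hx hy hw
  obtain ⟨hY, -, -⟩ := hD.commute_holonomy hw hx hz
  obtain ⟨-, hX, -⟩ := hD.commute_holonomy hy hw hz
  have h1 := hD.holonomy_eq_conj hx hy hz hw
  have hA : Commute (z * (z⁻¹ * w)⁻¹ * holonomy x y z * (z * (z⁻¹ * w)⁻¹)⁻¹) w := by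
    have : z * (z⁻¹ * w)⁻¹ * holonomy x y z * (z * (z⁻¹ * w)⁻¹)⁻¹ =
        (holonomy w x z)⁻¹ * holonomy x y w * (holonomy y w z)⁻¹ := by rw [h1]; group
    rw [this]
    exact (hY.inv_left.mul_left hk).mul_left hX.inv_left
  set r := z⁻¹ * w with hr
  have hwr : w = z * r := by rw [hr]; group
  have hB : Commute (holonomy x y z) (r * r * z * r⁻¹) := by
    have := (Commute.conj_iff (z * r⁻¹)⁻¹).mpr hA
    rwa [show (z * r⁻¹)⁻¹ * (z * r⁻¹ * holonomy x y z * (z * r⁻¹)⁻¹) * (z * r⁻¹)⁻¹⁻¹ =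
      holonomy x y z by group, show (z * r⁻¹)⁻¹ * w * (z * r⁻¹)⁻¹⁻¹ = r * r * z * r⁻¹ by
      rw [hwr]; group] at this
  have hC := (hWz.mul_right (hB.mul_right hWz.inv_right)).mul_right hWz.inv_right
  have hc := (hD.commute_displacement_conj hw hz).eq
  have hb := hD.braid_displacement hw hz
  rw [← hr, hwr] at hc hb
  have h2 : z * (z * r * z⁻¹) * z⁻¹ = r⁻¹ * (z * r * z⁻¹) := by
    rw [eq_inv_mul_iff_mul_eq]; exact hb.symm
  have hD : Commute (holonomy x y z)
      ((z * r * z⁻¹) * (z * r * z⁻¹) * (z * (z * r * z⁻¹) * z⁻¹)⁻¹) := by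
    rwa [show (z * r * z⁻¹) * (z * r * z⁻¹) * (z * (z * r * z⁻¹) * z⁻¹)⁻¹ =
      z * (r * r * z * r⁻¹ * z⁻¹) * z⁻¹ by group]
  rw [h2, mul_inv_rev, inv_inv] at hD
  rwa [hwr, ← hc, show z * r * z⁻¹ * r =
    z * r * z⁻¹ * (z * r * z⁻¹) * ((z * r * z⁻¹)⁻¹ * r) by group]

/-- The element `(1 + α) r` of the displacement group commutes with all displacements from `z`, and
so does `r ^ 3`. Here `r` is a displacement from `z` and `α` is conjugation by `z`. Modulo elements
commuting with the displacements, `α r` is both `r⁻¹` and, since all holonomies based at `z` fix the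
point to which `(1 + α) r` moves `z`, a square root of `r`. -/
theorem commute_mul_conj_displacement (hD : IsBraidSet D) {y z w : G} (hy : y ∈ D)
    (hz : z ∈ D) (hw : w ∈ D) : Commute ((z⁻¹ * w) * (w * z⁻¹)) (z⁻¹ * y) ∧
      Commute ((z⁻¹ * w) ^ 3) (z⁻¹ * y) := by
  set r := z⁻¹ * w with hr
  have hwr : w = z * r := by rw [hr]; group
  have hc := (hD.commute_displacement_conj hw hz).eq
  have hb := hD.braid_displacement hw hz
  rw [← hr] at hc hb
  have hm : z⁻¹ * r * z = r * (w * z⁻¹)⁻¹ := by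
    rw [eq_mul_inv_iff_mul_eq]
    calc _ = z⁻¹ * (r * (z * (w * z⁻¹) * z⁻¹)) * z := by rw [hwr]; group
      _ = r := by rw [← hb, hwr]; group
  -- the point obtained by moving `z` along `r * (w * z⁻¹)` is fixed by all holonomies at `z`
  have hu : (r * (w * z⁻¹)) * z * (r * (w * z⁻¹))⁻¹ ∈ D := by
    have := hD.inv_conj_mem hz (hD.conj_mem hw (hD.conj_mem hw hz))
    convert this using 1
    rw [hr]; group
  have key : ∀ y ∈ D, Commute (r * (w * z⁻¹)⁻¹ * (w * z⁻¹)⁻¹) (z⁻¹ * y) := by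
    intro y hy
    have := hD.commute_displacement hu hy hz fun x hx => by
      have h1 := hD.commute_holonomy_mul_conj hx hy hz hw
      have h2 := (hD.commute_holonomy hx hy hz).2.2
      exact (h1.mul_right h2).mul_right h1.inv_right
    rwa [show z⁻¹ * (r * (w * z⁻¹) * z * (r * (w * z⁻¹))⁻¹) =
      (z⁻¹ * r * z) * r * (r * (w * z⁻¹))⁻¹ by rw [hwr]; group, hm, ← hc,
      show r * (w * z⁻¹)⁻¹ * r * (w * z⁻¹ * r)⁻¹ = r * (w * z⁻¹)⁻¹ * (w * z⁻¹)⁻¹ by group] at this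
  have h1 := key y hy
  have h2 : Commute (r * (w * z⁻¹)) (z⁻¹ * y) := by
    have := (Commute.conj_iff z⁻¹).mpr (key _ (hD.conj_mem hz hy))
    rw [show z⁻¹ * (z⁻¹ * (z * y * z⁻¹)) * z⁻¹⁻¹ = z⁻¹ * y by group,
      show z⁻¹ * (r * (w * z⁻¹)⁻¹ * (w * z⁻¹)⁻¹) * z⁻¹⁻¹ = (z⁻¹ * r * z) * (r * r)⁻¹ by
        rw [hr]; group, hm,
      show r * (w * z⁻¹)⁻¹ * (r * r)⁻¹ = r * (r * (w * z⁻¹))⁻¹ * r⁻¹ by group, ← hc,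
      show r * (w * z⁻¹ * r)⁻¹ * r⁻¹ = (r * (w * z⁻¹))⁻¹ by group] at this
    exact Commute.inv_left_iff.mp this
  refine ⟨h2, ?_⟩
  have h3 : r ^ 3 = r * (w * z⁻¹)⁻¹ * (w * z⁻¹)⁻¹ * (r * (w * z⁻¹) * (r * (w * z⁻¹))) := by
    rw [← hc, show r * (w * z⁻¹)⁻¹ * (w * z⁻¹)⁻¹ * (w * z⁻¹ * r * (w * z⁻¹ * r)) =
      r * (w * z⁻¹)⁻¹ * (r * (w * z⁻¹)) * r by group, ← hc,
      show r * (w * z⁻¹)⁻¹ * (w * z⁻¹ * r) * r = r * r * r by group, pow_succ, pow_two]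
  rw [h3]
  exact h1.mul_left (h2.mul_left h2)

end IsBraidSet

/-- The properties of the set of displacements `z⁻¹ * x` of a braid set from one of its points `z`
that imply that any three of its elements generate a nilpotent group. -/
structure IsDisplacementSet (T : Set G) : Prop where
  inv_mem : ∀ {p}, p ∈ T → p⁻¹ ∈ T
  engel : ∀ {p q}, p ∈ T → q ∈ T → Commute ⁅p, q⁆ p
  cube : ∀ {p q}, p ∈ T → q ∈ T → Commute (p ^ 3) q
  cyclic : ∀ {p q r}, p ∈ T → q ∈ T → r ∈ T →
    p * r⁻¹ * q * p⁻¹ * r * q⁻¹ = q * p⁻¹ * r * q⁻¹ * p * r⁻¹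

theorem IsBraidSet.isDisplacementSet {D : Set G} (hD : IsBraidSet D) {z : G} (hz : z ∈ D) :
    IsDisplacementSet ((fun x => z⁻¹ * x) '' D) where
  inv_mem := by
    rintro _ ⟨x, hx, rfl⟩
    refine ⟨z * (z * (z * x * z⁻¹) * z⁻¹) * z⁻¹,
      hD.conj_mem hz (hD.conj_mem hz (hD.conj_mem hz hx)), ?_⟩
    rw [← hD.conj_cube_displacement hx hz]
    group
  engel := by
    rintro _ _ ⟨x, hx, rfl⟩ ⟨y, hy, rfl⟩
    simp only
    rw [hD.commutator_eq_holonomy hx hy hz]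
    obtain ⟨h1, -, h2⟩ := hD.commute_holonomy hx hy hz
    exact h2.inv_right.mul_right h1
  cube := by
    rintro _ _ ⟨x, hx, rfl⟩ ⟨y, hy, rfl⟩
    exact (hD.commute_mul_conj_displacement hy hz hx).2
  cyclic := by
    rintro _ _ _ ⟨x, hx, rfl⟩ ⟨y, hy, rfl⟩ ⟨w, hw, rfl⟩
    simp only
    -- both sides are conjugate to the holonomy of the three points
    have h := hD.holonomy_rotate hx hy hw
    calc _ = z⁻¹ * holonomy x y w * z := by unfold holonomy; group
      _ = _ := by rw [← h]; unfold holonomy; group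

end Holonomy

/-! ### Three displacements generate a nilpotent group -/

section DisplacementSet

open scoped commutatorElement

namespace IsDisplacementSet

variable {G : Type*} [Group G] {T : Set G}

theorem commute_right (hT : IsDisplacementSet T) {p q : G} (hp : p ∈ T) (hq : q ∈ T) :
    Commute ⁅p, q⁆ q := by
  rw [← commutatorElement_inv]
  exact (hT.engel hq hp).inv_left

theorem inv_left (hT : IsDisplacementSet T) {p q : G} (hp : p ∈ T) (hq : q ∈ T) :
    ⁅p⁻¹, q⁆ = ⁅p, q⁆⁻¹ := by
  have h := (hT.engel hp hq).inv_left.eq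
  calc ⁅p⁻¹, q⁆ = p⁻¹ * (⁅p, q⁆⁻¹ * p) := by simp only [commutatorElement_def]; group
    _ = _ := by rw [h]; group

theorem inv_right (hT : IsDisplacementSet T) {p q : G} (hp : p ∈ T) (hq : q ∈ T) :
    ⁅p, q⁻¹⁆ = ⁅p, q⁆⁻¹ := by
  rw [← commutatorElement_inv, hT.inv_left hq hp, commutatorElement_inv, commutatorElement_inv]

theorem pow_three (hT : IsDisplacementSet T) {p q : G} (hp : p ∈ T) (hq : q ∈ T) :
    ⁅p, q⁆ * ⁅p, q⁆ * ⁅p, q⁆ = 1 := by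
  have h := (hT.engel hp hq).eq
  have h3 := (hT.cube hp hq).eq
  have h1 : p * q = ⁅p, q⁆ * q * p := by simp only [commutatorElement_def]; group
  have h2 : p ^ 3 * q = ⁅p, q⁆ * ⁅p, q⁆ * ⁅p, q⁆ * q * p ^ 3 := by
    calc p ^ 3 * q = p * (p * (p * q)) := by simp only [pow_succ, pow_zero, one_mul, mul_assoc]
      _ = p * (p * ⁅p, q⁆ * q * p) := by rw [h1]; simp only [mul_assoc]
      _ = p * (⁅p, q⁆ * (p * q) * p) := by rw [← h]; simp only [mul_assoc]
      _ = (p * ⁅p, q⁆) * ⁅p, q⁆ * q * p * p := by rw [h1]; simp only [mul_assoc]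
      _ = ⁅p, q⁆ * (p * ⁅p, q⁆) * q * p * p := by
        conv_lhs => rw [← h]
        simp only [mul_assoc]
      _ = ⁅p, q⁆ * ⁅p, q⁆ * (p * q) * p * p := by rw [← h]; simp only [mul_assoc]
      _ = _ := by rw [h1]; simp only [pow_succ, pow_zero, one_mul, mul_assoc]
  rw [h3] at h2
  have := mul_right_cancel (b := p ^ 3) h2
  exact (mul_eq_right.mp this.symm)

/-- Conjugation by `r * r` agrees with conjugation by `r⁻¹` on commutators. -/
theorem conj_conj (hT : IsDisplacementSet T) {p q r : G} (hp : p ∈ T) (hq : q ∈ T)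
    (hr : r ∈ T) : r * (r * ⁅p, q⁆ * r⁻¹) * r⁻¹ = r⁻¹ * ⁅p, q⁆ * r := by
  have h1 := hT.cube hr hp
  have h2 := hT.cube hr hq
  have h : Commute (r ^ 3) ⁅p, q⁆ := by
    rw [commutatorElement_def]
    exact ((h1.mul_right h2).mul_right h1.inv_right).mul_right h2.inv_right
  calc _ = r⁻¹ * (r ^ 3 * ⁅p, q⁆) * r⁻¹ * r⁻¹ := by
        simp only [pow_succ, pow_zero, one_mul]; group
    _ = _ := by rw [h.eq]; simp only [pow_succ, pow_zero, one_mul]; group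

/-- The cyclic relation, rewritten in terms of the three commutators of `p`, `q`, `r`. -/
theorem cyclic_commutator (hT : IsDisplacementSet T) {p q r : G} (hp : p ∈ T) (hq : q ∈ T)
    (hr : r ∈ T) : ⁅r, p⁆ * (r⁻¹ * ⁅p, q⁆ * r) * ⁅q, r⁆ =
      ⁅p, q⁆ * (p⁻¹ * ⁅q, r⁆ * p) * ⁅r, p⁆ := by
  have h1 := (hT.engel hr hp).inv_right.eq
  have h2 := (hT.commute_right hq hr).eq
  have h3 := (hT.engel hp hq).inv_right.eq
  have h4 := (hT.commute_right hr hp).eq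
  calc _ = (⁅r, p⁆ * r⁻¹) * ⁅p, q⁆ * (r * ⁅q, r⁆) := by group
    _ = (r⁻¹ * ⁅r, p⁆) * ⁅p, q⁆ * (⁅q, r⁆ * r) := by rw [h1, h2]
    _ = p * r⁻¹ * q * p⁻¹ * r * q⁻¹ := by simp only [commutatorElement_def]; group
    _ = (p⁻¹ * ⁅p, q⁆) * ⁅q, r⁆ * (⁅r, p⁆ * p) := by
      rw [hT.cyclic hp hq hr]; simp only [commutatorElement_def]; group
    _ = _ := by rw [← h3, h4]; group

theorem conj_conj_pos (hT : IsDisplacementSet T) {p q r : G} (hp : p ∈ T) (hq : q ∈ T) :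
    p * (r * ⁅p, q⁆ * r⁻¹) * p⁻¹ = ⁅r, p⁆⁻¹ * (r * ⁅p, q⁆ * r⁻¹) * ⁅r, p⁆ := by
  have h := (hT.engel hp hq).eq
  calc _ = ⁅r, p⁆⁻¹ * r * (p * ⁅p, q⁆) * p⁻¹ * r⁻¹ * ⁅r, p⁆ := by
        simp only [commutatorElement_def]; group
    _ = _ := by rw [← h]; group

theorem conj_conj_neg (hT : IsDisplacementSet T) {p q r : G} (hp : p ∈ T) (hq : q ∈ T)
    (hr : r ∈ T) :
    p * (r⁻¹ * ⁅p, q⁆ * r) * p⁻¹ = ⁅r, p⁆ * (r⁻¹ * ⁅p, q⁆ * r) * ⁅r, p⁆⁻¹ := by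
  have := hT.conj_conj_pos (r := r⁻¹) hp hq
  rwa [hT.inv_left hr hp, inv_inv, inv_inv] at this

theorem cyclic_commutator' (hT : IsDisplacementSet T) {p q r : G} (hp : p ∈ T) (hq : q ∈ T)
    (hr : r ∈ T) : (r * ⁅p, q⁆ * r⁻¹) * ⁅r, p⁆ * (p * ⁅q, r⁆ * p⁻¹) =
      ⁅r, p⁆ * (r⁻¹ * ⁅p, q⁆ * r) * ⁅q, r⁆ := by
  have h1 := hT.cyclic_commutator (hT.inv_mem hp) (hT.inv_mem hq) (hT.inv_mem hr)
  simp only [hT.inv_left, hT.inv_right, hT.inv_mem, hp, hq, hr, inv_inv] at h1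
  have h2 := hT.conj_conj hq hr hp
  have h3 := (hT.engel hp hq).eq
  have h4 := (hT.commute_right hr hp).eq
  have h5 := (hT.commute_right hr hp).inv_right.eq
  have h6 := hT.conj_conj_pos (r := r) hp hq
  calc _ = ⁅r, p⁆ * (⁅r, p⁆⁻¹ * (r * ⁅p, q⁆ * r⁻¹) * ⁅r, p⁆) * (p * ⁅q, r⁆ * p⁻¹) := by group
    _ = ⁅r, p⁆ * (p * (r * ⁅p, q⁆ * r⁻¹) * p⁻¹) * (p * ⁅q, r⁆ * p⁻¹) := by rw [h6]
    _ = ⁅r, p⁆ * p * (r * ⁅p, q⁆ * r⁻¹) * ⁅q, r⁆ * p⁻¹ := by group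
    _ = p * (⁅r, p⁆ * (r * ⁅p, q⁆ * r⁻¹) * ⁅q, r⁆) * p⁻¹ := by rw [h4]; group
    _ = (p * ⁅p, q⁆) * (p * ⁅q, r⁆ * p⁻¹) * (⁅r, p⁆ * p⁻¹) := by rw [h1]; group
    _ = ⁅p, q⁆ * (p * (p * ⁅q, r⁆ * p⁻¹) * p⁻¹) * ⁅r, p⁆ := by rw [h5, ← h3]; group
    _ = _ := by rw [h2, hT.cyclic_commutator hp hq hr]

theorem conj_mul_conj (hT : IsDisplacementSet T) {p q r : G} (hp : p ∈ T) (hq : q ∈ T)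
    (hr : r ∈ T) :
    (⁅r, p⁆⁻¹ * (r * ⁅p, q⁆ * r⁻¹) * ⁅r, p⁆) * (⁅r, p⁆ * (r⁻¹ * ⁅p, q⁆ * r) * ⁅r, p⁆⁻¹) =
      (r⁻¹ * ⁅p, q⁆ * r) * (r * ⁅p, q⁆ * r⁻¹) := by
  have h1 := hT.cyclic_commutator' hp hq hr
  have h2 := hT.cyclic_commutator' hp (hT.inv_mem hq) (hT.inv_mem hr)
  simp only [hT.inv_left, hT.inv_right, hT.inv_mem, hp, hq, hr, inv_inv] at h2
  generalize ⁅r, p⁆ = Y at *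
  generalize ⁅q, r⁆ = X at *
  generalize ⁅p, q⁆ = W at *
  have h3 : p * X * p⁻¹ = Y⁻¹ * (r * W * r⁻¹)⁻¹ * (Y * (r⁻¹ * W * r) * X) := by rw [← h1]; group
  have h4 : p * X * p⁻¹ = (Y * (r⁻¹ * W * r)) * (Y⁻¹ * (r * W⁻¹ * r⁻¹) * X) := by
    rw [← h2]; group
  rw [h4] at h3
  have h5 : Y * (r⁻¹ * W * r) * Y⁻¹ * (r * W⁻¹ * r⁻¹) =
      Y⁻¹ * (r * W * r⁻¹)⁻¹ * (Y * (r⁻¹ * W * r)) := by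
    apply mul_right_cancel (b := X)
    simpa only [mul_assoc] using h3
  calc _ = (Y⁻¹ * (r * W * r⁻¹) * Y) * (Y * (r⁻¹ * W * r) * Y⁻¹ * (r * W⁻¹ * r⁻¹)) *
        (r * W * r⁻¹) := by group
    _ = _ := by rw [h5]; group

theorem conj_mul_conj' (hT : IsDisplacementSet T) {p q r : G} (hp : p ∈ T) (hq : q ∈ T)
    (hr : r ∈ T) :
    (⁅r, p⁆ * (r⁻¹ * ⁅p, q⁆ * r) * ⁅r, p⁆⁻¹) * (⁅r, p⁆⁻¹ * (r * ⁅p, q⁆ * r⁻¹) * ⁅r, p⁆) =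
      (r * ⁅p, q⁆ * r⁻¹) * (r⁻¹ * ⁅p, q⁆ * r) := by
  have h1 := hT.conj_mul_conj hp (hT.inv_mem hq) hr
  simp only [hT.inv_right, hp, hq] at h1
  rw [← inv_inj]
  simp only [mul_inv_rev, inv_inv, mul_assoc] at h1 ⊢
  exact h1

/-- The commutation relation between `⁅q, r⁆` and `⁅r, p⁆`, obtained by comparing two values of
`p * ⁅q, r⁆ * p⁻¹` that the cyclic relation yields for different choices of signs. -/
theorem mul_commutator (hT : IsDisplacementSet T) {p q r : G} (hp : p ∈ T) (hq : q ∈ T)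
    (hr : r ∈ T) :
    (r⁻¹ * ⁅p, q⁆ * r) * (r * ⁅p, q⁆ * r⁻¹) * ⁅p, q⁆ * ⁅r, p⁆⁻¹ * ⁅q, r⁆ =
      ⁅q, r⁆ * ⁅r, p⁆⁻¹ := by
  have h1 := hT.cyclic_commutator (hT.inv_mem hp) (hT.inv_mem hq) (hT.inv_mem hr)
  have h2 := hT.cyclic_commutator (hT.inv_mem hp) hq hr
  have h3 := hT.conj_mul_conj' (hT.inv_mem hp) (hT.inv_mem hq) (hT.inv_mem hr)
  simp only [hT.inv_left, hT.inv_right, hT.inv_mem, hp, hq, hr, inv_inv] at h1 h2 h3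
  have h4 := hT.conj_conj hp hq hr
  have h5 := (hT.engel hr hp).eq
  have h5' := (hT.engel hr hp).inv_left.eq
  have hW := hT.pow_three hp hq
  have hY := hT.pow_three hr hp
  have h7 : (⁅r, p⁆ * ⁅p, q⁆ * ⁅r, p⁆⁻¹) * (⁅r, p⁆⁻¹ * (r * ⁅p, q⁆ * r⁻¹) * ⁅r, p⁆) =
      (r * ⁅p, q⁆ * r⁻¹) * ⁅p, q⁆ := by
    generalize ⁅r, p⁆ = Y at *
    generalize ⁅p, q⁆ = W at *
    have hYr : r⁻¹ * Y * r = Y := by rw [mul_assoc, h5]; group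
    have h10 : r⁻¹ * (r⁻¹ * W * r) * r = r * W * r⁻¹ := by rw [← h4]; group
    calc _ = ((r⁻¹ * Y * r) * W * (r⁻¹ * Y * r)⁻¹) *
          ((r⁻¹ * Y * r)⁻¹ * (r⁻¹ * (r⁻¹ * W * r) * r) * (r⁻¹ * Y * r)) := by rw [hYr, h10]
      _ = r⁻¹ * ((Y * (r * W * r⁻¹) * Y⁻¹) * (Y⁻¹ * (r⁻¹ * W * r) * Y)) * r := by group
      _ = (r⁻¹ * (r⁻¹ * W * r) * r) * W := by rw [h3]; group
      _ = _ := by rw [h10]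
  generalize ⁅r, p⁆ = Y at *
  generalize ⁅q, r⁆ = X at *
  generalize ⁅p, q⁆ = W at *
  have hY2 : Y * Y = Y⁻¹ := by rw [eq_inv_iff_mul_eq_one]; exact hY
  have hW2 : W⁻¹ * W⁻¹ = W := by rw [← mul_inv_rev, inv_eq_iff_mul_eq_one]; exact hW
  have h8 : p * X * p⁻¹ = W⁻¹ * (Y * (r * W * r⁻¹) * X) * Y⁻¹ := by rw [h1]; group
  have h9 : p * X * p⁻¹ = W * (Y⁻¹ * (r⁻¹ * W⁻¹ * r) * X) * Y := by rw [h2]; group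
  rw [h8] at h9
  calc _ = (r⁻¹ * W * r) * ((r * W * r⁻¹) * W) * Y⁻¹ * X := by group
    _ = (r⁻¹ * W * r) * (Y * W * Y⁻¹) * Y⁻¹ * (r * W * r⁻¹) * X := by rw [← h7]; group
    _ = (r⁻¹ * W * r) * Y * W * (Y * Y)⁻¹ * (r * W * r⁻¹) * X := by group
    _ = (r⁻¹ * W * r) * Y * (W⁻¹ * W⁻¹) * Y * (r * W * r⁻¹) * X := by rw [hY2, hW2]; group
    _ = (r⁻¹ * W * r) * Y * W⁻¹ * (W⁻¹ * (Y * (r * W * r⁻¹) * X) * Y⁻¹) * Y := by group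
    _ = X * (Y * Y) := by rw [h9]; group
    _ = _ := by rw [hY2]

/-- The conjugates of a commutator `⁅p, q⁆` by powers of `r` commute with each other. -/
theorem commute_conj_neg_conj (hT : IsDisplacementSet T) {p q r : G} (hp : p ∈ T) (hq : q ∈ T)
    (hr : r ∈ T) : Commute (r⁻¹ * ⁅p, q⁆ * r) (r * ⁅p, q⁆ * r⁻¹) := by
  have h1 := hT.mul_commutator hp hq hr
  have h2 := hT.mul_commutator (hT.inv_mem hp) (hT.inv_mem hq) (hT.inv_mem hr)
  simp only [hT.inv_left, hT.inv_right, hT.inv_mem, hp, hq, hr, inv_inv] at h2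
  rw [← h2] at h1
  exact mul_right_cancel (mul_right_cancel (mul_right_cancel h1))

theorem commute_conj (hT : IsDisplacementSet T) {p q r : G} (hp : p ∈ T) (hq : q ∈ T)
    (hr : r ∈ T) : Commute ⁅p, q⁆ (r * ⁅p, q⁆ * r⁻¹) := by
  have h1 := hT.commute_conj_neg_conj hp hq hr
  have h4 := hT.conj_conj hp hq hr
  have h := (Commute.conj_iff r).mpr h1
  rw [h4, show r * (r⁻¹ * ⁅p, q⁆ * r) * r⁻¹ = ⁅p, q⁆ by group] at h
  have h' := (Commute.conj_iff r).mpr h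
  rw [show r * (r⁻¹ * ⁅p, q⁆ * r) * r⁻¹ = ⁅p, q⁆ by group] at h'
  exact h'.symm

theorem commute_conj_neg (hT : IsDisplacementSet T) {p q r : G} (hp : p ∈ T) (hq : q ∈ T)
    (hr : r ∈ T) : Commute ⁅p, q⁆ (r⁻¹ * ⁅p, q⁆ * r) := by
  have := hT.commute_conj hp hq (hT.inv_mem hr)
  rwa [inv_inv] at this

/-- The commutator `⁅⁅q, r⁆, ⁅r, p⁆⁻¹⁆` is the product of the three conjugates of `⁅p, q⁆` by the
powers of `r`. -/
theorem commutator_commutator (hT : IsDisplacementSet T) {p q r : G} (hp : p ∈ T) (hq : q ∈ T)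
    (hr : r ∈ T) : ⁅⁅q, r⁆, ⁅r, p⁆⁻¹⁆ =
      ⁅p, q⁆ * (r * ⁅p, q⁆ * r⁻¹) * (r⁻¹ * ⁅p, q⁆ * r) := by
  have h := hT.mul_commutator hp hq hr
  have c1 := hT.commute_conj hp hq hr
  have c2 := hT.commute_conj_neg hp hq hr
  have c3 := hT.commute_conj_neg_conj hp hq hr
  calc _ = ⁅q, r⁆ * ⁅r, p⁆⁻¹ * ⁅q, r⁆⁻¹ * ⁅r, p⁆ := by
        rw [commutatorElement_def ⁅q, r⁆, inv_inv]
    _ = (r⁻¹ * ⁅p, q⁆ * r) * (r * ⁅p, q⁆ * r⁻¹) * ⁅p, q⁆ := by rw [← h]; group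
    _ = _ := by rw [← (c2.mul_right c1).eq, c3.eq, ← mul_assoc]

/-- For `p`, `q`, `r` in a displacement set, `⁅⁅q, r⁆, ⁅r, p⁆⁻¹⁆` is central in the subgroup that
they generate. -/
theorem commute_commutator_commutator (hT : IsDisplacementSet T) {p q r : G} (hp : p ∈ T)
    (hq : q ∈ T) (hr : r ∈ T) : Commute ⁅⁅q, r⁆, ⁅r, p⁆⁻¹⁆ p ∧ Commute ⁅⁅q, r⁆, ⁅r, p⁆⁻¹⁆ q ∧
      Commute ⁅⁅q, r⁆, ⁅r, p⁆⁻¹⁆ r := by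
  have hcp : ∀ {p q : G}, p ∈ T → q ∈ T →
      Commute (⁅p, q⁆ * (r * ⁅p, q⁆ * r⁻¹) * (r⁻¹ * ⁅p, q⁆ * r)) p := by
    intro p q hp hq
    have h1 := hT.conj_conj_pos (r := r) hp hq
    have h2 := hT.conj_conj_neg hp hq hr
    have h3 := hT.conj_mul_conj hp hq hr
    have h4 := (hT.commute_conj_neg_conj hp hq hr).eq
    have h5 := (hT.engel hp hq).eq
    refine (mul_inv_eq_iff_eq_mul.mp ?_ : p * _ = _ * p).symm
    calc _ = (p * ⁅p, q⁆) * p⁻¹ * (p * (r * ⁅p, q⁆ * r⁻¹) * p⁻¹) *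
          (p * (r⁻¹ * ⁅p, q⁆ * r) * p⁻¹) := by group
      _ = ⁅p, q⁆ * ((⁅r, p⁆⁻¹ * (r * ⁅p, q⁆ * r⁻¹) * ⁅r, p⁆) *
          (⁅r, p⁆ * (r⁻¹ * ⁅p, q⁆ * r) * ⁅r, p⁆⁻¹)) := by rw [← h5, h1, h2]; group
      _ = _ := by rw [h3, h4]; exact (mul_assoc _ _ _).symm
  rw [hT.commutator_commutator hp hq hr]
  refine ⟨hcp hp hq, ?_, ?_⟩
  · have h := (hcp hq hp).inv_left
    have c1 := hT.commute_conj hp hq hr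
    have c2 := hT.commute_conj_neg hp hq hr
    have c3 := hT.commute_conj_neg_conj hp hq hr
    have e : (⁅q, p⁆ * (r * ⁅q, p⁆ * r⁻¹) * (r⁻¹ * ⁅q, p⁆ * r))⁻¹ =
        (r⁻¹ * ⁅p, q⁆ * r) * (r * ⁅p, q⁆ * r⁻¹) * ⁅p, q⁆ := by
      simp only [← commutatorElement_inv p q, mul_inv_rev, inv_inv, mul_assoc]
    rw [e, ← (c2.mul_right c1).eq, c3.eq, ← mul_assoc] at h
    exact h
  · have h4 := hT.conj_conj hp hq hr
    have c1 := hT.commute_conj hp hq hr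
    have c2 := hT.commute_conj_neg hp hq hr
    refine (mul_inv_eq_iff_eq_mul.mp ?_ : r * _ = _ * r).symm
    calc _ = (r * ⁅p, q⁆ * r⁻¹) * (r * (r * ⁅p, q⁆ * r⁻¹) * r⁻¹) * ⁅p, q⁆ := by
          generalize ⁅p, q⁆ = W
          group
      _ = _ := by rw [h4, ← (c1.mul_right c2).eq]; exact (mul_assoc _ _ _).symm

end IsDisplacementSet

theorem Subgroup.mem_upperCentralSeries_succ_of_closure {G : Type*} [Group G] {S : Set G}
    (hS : closure S = ⊤) {n : ℕ} {x : G} (h : ∀ y ∈ S, ⁅x, y⁆ ∈ upperCentralSeries G n) :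
    x ∈ upperCentralSeries G (n + 1) := by
  rw [mem_upperCentralSeries_succ_iff]
  intro y
  have hy : y ∈ closure S := hS ▸ mem_top y
  induction hy using closure_induction with
  | mem y hy => exact h y hy
  | one => rw [commutatorElement_one_right]; exact one_mem _
  | mul y z _ _ hy hz =>
    rw [show ⁅x, y * z⁆ = ⁅x, y⁆ * (y * ⁅x, z⁆ * y⁻¹) by simp only [commutatorElement_def]; group]
    exact mul_mem hy (Normal.conj_mem inferInstance _ hz y)
  | inv y _ hy =>
    rw [show ⁅x, y⁻¹⁆ = y⁻¹ * ⁅x, y⁆⁻¹ * y⁻¹⁻¹ by simp only [commutatorElement_def]; group]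
    exact Normal.conj_mem inferInstance _ (inv_mem hy) y⁻¹

namespace IsDisplacementSet

variable {G : Type*} [Group G] {T : Set G}

/-- If `⁅p, q⁆ = W` and `t = ⁅W, r⁆`, the commutators of `t` with the three generators are
conjugates of central elements such as `⁅⁅q, r⁆, ⁅r, p⁆⁻¹⁆` or of their inverses. So `t`, `W` and the
generators lie in the second, third and fourth term of the upper central series. -/
theorem isNilpotent_of_closure_eq_top (hT : IsDisplacementSet T) {p q r : G} (hp : p ∈ T)
    (hq : q ∈ T) (hr : r ∈ T) (hS : Subgroup.closure {p, q, r} = ⊤) : Group.IsNilpotent G := by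
  -- it suffices to test membership in the upper central series on the three generators
  have step : ∀ {n : ℕ} {x a b c : G}, Subgroup.closure {a, b, c} = ⊤ →
      ⁅x, a⁆ ∈ Subgroup.upperCentralSeries G n → ⁅x, b⁆ ∈ Subgroup.upperCentralSeries G n →
      ⁅x, c⁆ ∈ Subgroup.upperCentralSeries G n → x ∈ Subgroup.upperCentralSeries G (n + 1) := by
    intro n x a b c h h1 h2 h3
    refine Subgroup.mem_upperCentralSeries_succ_of_closure h ?_
    rintro y (rfl | rfl | rfl) <;> assumption
  have one : ∀ {n : ℕ} {x y : G}, Commute x y → ⁅x, y⁆ ∈ Subgroup.upperCentralSeries G n := by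
    intro n x y h
    rw [commutatorElement_eq_one_iff_commute.mpr h]; exact one_mem _
  have key1 : ∀ {p q r : G}, p ∈ T → q ∈ T → r ∈ T → Subgroup.closure {p, q, r} = ⊤ →
      ⁅⁅q, r⁆, ⁅r, p⁆⁻¹⁆ ∈ Subgroup.upperCentralSeries G 1 := by
    intro p q r hp hq hr hS
    obtain ⟨h1, h2, h3⟩ := hT.commute_commutator_commutator hp hq hr
    exact step hS (one h1) (one h2) (one h3)
  have rot : ∀ {a b c : G}, Subgroup.closure {a, b, c} = ⊤ →
      Subgroup.closure {b, c, a} = (⊤ : Subgroup G) := by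
    intro a b c h
    rw [← h]; congr 1; ext; simp only [Set.mem_insert_iff, Set.mem_singleton_iff]; tauto
  have swap : ∀ {a b c : G}, Subgroup.closure {a, b, c} = ⊤ →
      Subgroup.closure {b, a, c} = (⊤ : Subgroup G) := by
    intro a b c h
    rw [← h]; congr 1; ext; simp only [Set.mem_insert_iff, Set.mem_singleton_iff]; tauto
  have key2 : ∀ {p q r : G}, p ∈ T → q ∈ T → r ∈ T → Subgroup.closure {p, q, r} = ⊤ →
      ⁅⁅⁅p, q⁆, r⁆, p⁆ ∈ Subgroup.upperCentralSeries G 1 := by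
    intro p q r hp hq hr hS
    have h1 := key1 hq hr hp (rot hS)
    have h2 := hT.conj_conj_pos (r := r) hp hq
    have h4 := hT.engel hp hq
    have h5 : ⁅⁅⁅p, q⁆, r⁆, p⁆ = (⁅p, q⁆ * r * ⁅r, p⁆⁻¹) * ⁅⁅r, p⁆, ⁅p, q⁆⁻¹⁆ *
        (⁅p, q⁆ * r * ⁅r, p⁆⁻¹)⁻¹ := by
      have h6 := hT.engel hr hp
      generalize ⁅r, p⁆ = Y at *
      generalize ⁅p, q⁆ = W at *
      have e1 : p * W⁻¹ * p⁻¹ = W⁻¹ := by rw [h4.symm.inv_right.eq]; group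
      have e2 : r⁻¹ * Y⁻¹ * r = Y⁻¹ := by rw [mul_assoc, h6.inv_left.eq]; group
      have e3 : r⁻¹ * Y * r = Y := by rw [mul_assoc, h6.eq]; group
      calc _ = W * r * W⁻¹ * r⁻¹ * (p * (r * W * r⁻¹) * p⁻¹) * (p * W⁻¹ * p⁻¹) := by
            simp only [commutatorElement_def]; group
        _ = W * r * W⁻¹ * r⁻¹ * (Y⁻¹ * (r * W * r⁻¹) * Y) * W⁻¹ := by rw [h2, e1]
        _ = W * r * W⁻¹ * (r⁻¹ * Y⁻¹ * r) * W * (r⁻¹ * Y * r) * r⁻¹ * W⁻¹ := by group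
        _ = _ := by rw [e2, e3]; simp only [commutatorElement_def]; group
    rw [h5]
    exact Subgroup.Normal.conj_mem inferInstance _ h1 _
  have key3 : ∀ {p q r : G}, p ∈ T → q ∈ T → r ∈ T → Subgroup.closure {p, q, r} = ⊤ →
      ⁅p, q⁆ ∈ Subgroup.upperCentralSeries G 3 := by
    intro p q r hp hq hr hS
    refine step hS (one (hT.engel hp hq)) (one (hT.commute_right hp hq)) ?_
    refine step hS (key2 hp hq hr hS) ?_ ?_
    · have h := key2 hq hp hr (swap hS)
      have c := (hT.commute_conj hp hq hr).inv_left.eq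
      have e : ⁅⁅q, p⁆, r⁆ = ⁅⁅p, q⁆, r⁆⁻¹ := by
        rw [← commutatorElement_inv p q]
        generalize ⁅p, q⁆ = W at *
        calc _ = W⁻¹ * (r * W * r⁻¹) := by simp only [commutatorElement_def]; group
          _ = _ := by rw [c]; simp only [commutatorElement_def]; group
      rw [e] at h
      generalize ⁅⁅p, q⁆, r⁆ = t at *
      rw [show ⁅t, q⁆ = t * ⁅t⁻¹, q⁆⁻¹ * t⁻¹ by simp only [commutatorElement_def]; group]
      exact Subgroup.Normal.conj_mem inferInstance _ (Subgroup.inv_mem _ h) _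
    · have h := key1 hp hq hr hS
      rw [hT.commutator_commutator hp hq hr] at h
      have c := (hT.commute_conj_neg_conj hp hq hr).inv_right.eq
      have h3 := hT.pow_three hp hq
      have h4 := hT.conj_conj hp hq hr
      convert h using 1
      generalize ⁅p, q⁆ = W at *
      have e : W⁻¹ * W⁻¹ = W := by rw [← mul_inv_rev, inv_eq_iff_mul_eq_one]; exact h3
      calc _ = W * (r * W * r⁻¹)⁻¹ * ((r * (r * W * r⁻¹) * r⁻¹) * (r * W * r⁻¹)⁻¹) := by
            simp only [commutatorElement_def]; group
        _ = W * (r * (W⁻¹ * W⁻¹) * r⁻¹) * (r⁻¹ * W * r) := by rw [h4, c]; group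
        _ = _ := by rw [e]
  have mem : ∀ {p q r : G}, p ∈ T → q ∈ T → r ∈ T → Subgroup.closure {p, q, r} = ⊤ →
      p ∈ Subgroup.upperCentralSeries G 4 := by
    intro p q r hp hq hr hS
    refine step hS (one (Commute.refl p)) (key3 hp hq hr hS) ?_
    rw [← commutatorElement_inv]
    exact Subgroup.inv_mem _ (key3 hr hp hq (rot (rot hS)))
  refine ⟨4, eq_top_iff.mpr (hS ▸ (Subgroup.closure_le _).mpr ?_)⟩
  rintro y (rfl | rfl | rfl)
  · exact mem hp hq hr hS
  · exact mem hq hr hp (rot hS)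
  · exact mem hr hp hq (rot (rot hS))

/-- Any three elements of a displacement set generate a nilpotent group, of class at most four. -/
theorem isNilpotent_closure (hT : IsDisplacementSet T) {p q r : G} (hp : p ∈ T)
    (hq : q ∈ T) (hr : r ∈ T) : Group.IsNilpotent (Subgroup.closure {p, q, r}) := by
  set K := Subgroup.closure {p, q, r} with hK
  have hT' : IsDisplacementSet (((↑) : K → G) ⁻¹' T) :=
    { inv_mem := fun h => by simpa using hT.inv_mem h
      engel := fun h1 h2 => Subtype.ext (hT.engel h1 h2)
      cube := fun h1 h2 => Subtype.ext (hT.cube h1 h2)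
      cyclic := fun h1 h2 h3 => Subtype.ext (hT.cyclic h1 h2 h3) }
  have hsub : {p, q, r} ⊆ (K : Set G) := Subgroup.subset_closure
  have hpK : p ∈ K := hsub (by simp)
  have hqK : q ∈ K := hsub (by simp)
  have hrK : r ∈ K := hsub (by simp)
  refine hT'.isNilpotent_of_closure_eq_top (p := ⟨p, hpK⟩) (q := ⟨q, hqK⟩) (r := ⟨r, hrK⟩)
    hp hq hr ?_
  have := Subgroup.closure_closure_coe_preimage (k := ({p, q, r} : Set G))
  rw [← this]
  congr 1
  ext ⟨x, hx⟩
  simp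

end IsDisplacementSet

end DisplacementSet

/-! ### Nilpotency from pairs of elements -/

theorem Subgroup.exists_mem_normalizer_inter {G : Type*} [Group G] [Finite G] {X : Set G}
    (hX : ∀ g, ∀ x ∈ X, g * x * g⁻¹ ∈ X) {P H : Subgroup G} [Group.IsNilpotent P] (hHP : H ≤ P)
    (hne : ∃ x ∈ X, x ∈ P ∧ x ∉ H) :
    ∃ x ∈ X, x ∈ P ∧ x ∉ H ∧ x ∈ Subgroup.normalizer (X ∩ H) := by
  -- a maximal `K` between `H` and `P` with `X ∩ K = X ∩ H`; its normalizer in `P` is larger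
  obtain ⟨K, hK⟩ := (Set.toFinite {K : Subgroup G | H ≤ K ∧ K ≤ P ∧ ∀ x ∈ X, x ∈ K → x ∈ H}
    ).exists_maximal ⟨H, le_rfl, hHP, fun x _ h => h⟩
  obtain ⟨hHK, hKP, hKX⟩ := hK.prop
  have hlt : K.subgroupOf P < ⊤ := by
    rw [lt_top_iff_ne_top, Ne, Subgroup.subgroupOf_eq_top]
    intro hPK
    obtain ⟨x, hx, hxP, hxH⟩ := hne
    exact hxH (hKX x hx (hPK hxP))
  obtain ⟨-, hlt⟩ := Group.normalizerCondition_of_isNilpotent _ hlt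
  obtain ⟨⟨g, hgP⟩, hgn, hgK⟩ := Set.not_subset.mp hlt
  have hgn' : g ∈ Subgroup.normalizer (K : Set G) := by
    rw [Subgroup.mem_normalizer_iff]
    rw [SetLike.mem_coe, Subgroup.mem_normalizer_iff] at hgn
    intro h
    constructor
    · intro hh
      exact (hgn ⟨h, hKP hh⟩).mp hh
    · intro hh
      have hP : h ∈ P := by
        have := P.mul_mem (P.mul_mem (P.inv_mem hgP) (hKP hh)) hgP
        rwa [show g⁻¹ * (g * h * g⁻¹) * g = h by group] at this
      exact (hgn ⟨h, hP⟩).mpr hh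
  by_contra! hcon
  refine hgK (hK.le_of_ge (y := Subgroup.normalizer (K : Set G) ⊓ P) ⟨?_, inf_le_right, ?_⟩ ?_
    ⟨hgn', hgP⟩)
  · exact le_inf (hHK.trans Subgroup.le_normalizer) hHP
  · rintro x hx ⟨hxn, hxP⟩
    by_contra hxH
    refine hcon x hx hxP hxH ?_
    replace hxn := Subgroup.mem_normalizer_iff.mp hxn
    rw [Subgroup.mem_set_normalizer_iff]
    have hconj : ∀ h, h ∈ X ↔ x * h * x⁻¹ ∈ X := fun h =>
      ⟨hX x h, fun hh => by
        have := hX x⁻¹ _ hh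
        rwa [show x⁻¹ * (x * h * x⁻¹) * x⁻¹⁻¹ = h by group] at this⟩
    intro h
    constructor
    · rintro ⟨h1, h2⟩
      exact ⟨(hconj h).mp h1, hKX _ ((hconj h).mp h1) ((hxn h).mp (hHK h2))⟩
    · rintro ⟨h1, h2⟩
      exact ⟨(hconj h).mpr h1, hKX _ ((hconj h).mpr h1) ((hxn h).mpr (hHK h2))⟩
  · exact le_inf Subgroup.le_normalizer hKP

/-- A form of the Baer–Suzuki theorem: in a finite group, if any two elements of a
conjugation-invariant set generate a `p`-group, the whole set does. -/
theorem IsPGroup.closure_of_pairs {G : Type*} [Group G] [Finite G] {p : ℕ} [Fact p.Prime]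
    {X : Set G} (hX : ∀ g, ∀ x ∈ X, g * x * g⁻¹ ∈ X)
    (hp : ∀ x ∈ X, ∀ y ∈ X, IsPGroup p (Subgroup.closure {x, y})) :
    IsPGroup p (Subgroup.closure X) := by
  have hle : ∀ P Q : Sylow p G, (∀ x ∈ X, x ∈ P → x ∈ Q) → ∀ x ∈ X, x ∈ Q → x ∈ P := by
    intro P Q h
    obtain ⟨g, rfl⟩ := MulAction.exists_smul_eq G P Q
    -- conjugation by `g` maps `X ∩ P` onto `X ∩ gPg⁻¹`, so the inclusion is an equality
    have hfin : (X ∩ (P : Set G)).Finite := Set.toFinite _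
    have hmaps : Set.MapsTo (fun x => g⁻¹ * x * g) (X ∩ (P : Set G)) (X ∩ (P : Set G)) := by
      rintro x ⟨hx, hxP⟩
      refine ⟨by simpa using hX g⁻¹ x hx, ?_⟩
      have h1 := h x hx hxP
      rw [← SetLike.mem_coe, Sylow.coe_smul, Set.mem_smul_set_iff_inv_smul_mem] at h1
      simpa using h1
    intro x hx hxg
    rw [← SetLike.mem_coe, Sylow.coe_smul, Set.mem_smul_set_iff_inv_smul_mem] at hxg
    have hs := (hfin.injOn_iff_bijOn_of_mapsTo hmaps).mp
      (fun a _ b _ hab => by simpa using hab)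
    obtain ⟨y, hy, hyx⟩ := hs.surjOn (show g⁻¹ * x * g ∈ X ∩ (P : Set G) from
      ⟨by simpa using hX g⁻¹ x hx, by simpa using hxg⟩)
    have : y = x := by simpa using hyx
    exact this ▸ hy.2
  have hall : ∀ P Q : Sylow p G, ∀ x ∈ X, x ∈ P → x ∈ Q := by
    by_contra! hcon
    obtain ⟨P₀, Q₀, h₀⟩ := hcon
    obtain ⟨⟨P, Q⟩, hPQ, hmax⟩ := Set.exists_max_image
      {T : Sylow p G × Sylow p G | ∃ x ∈ X, x ∈ T.1 ∧ x ∉ T.2}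
      (fun T => (X ∩ ((T.1 ⊓ T.2 : Subgroup G) : Set G)).ncard) (Set.toFinite _) ⟨(P₀, Q₀), h₀⟩
    have hQP : ∃ x ∈ X, x ∈ Q ∧ x ∉ P := by
      by_contra! h
      obtain ⟨x, hx, hxP, hxQ⟩ := hPQ
      exact hxQ (hle Q P h x hx hxP)
    have := P.isPGroup'.isNilpotent
    have := Q.isPGroup'.isNilpotent
    obtain ⟨x, hx, hxP, hxQ, hxn⟩ := Subgroup.exists_mem_normalizer_inter hX
      (inf_le_left : (P ⊓ Q : Subgroup G) ≤ P) (by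
        obtain ⟨x, hx, hxP, hxQ⟩ := hPQ
        exact ⟨x, hx, hxP, fun h => hxQ h.2⟩)
    obtain ⟨y, hy, hyQ, hyP, hyn⟩ := Subgroup.exists_mem_normalizer_inter hX
      (inf_le_right : (P ⊓ Q : Subgroup G) ≤ Q) (by
        obtain ⟨x, hx, hxP, hxQ⟩ := hQP
        exact ⟨x, hx, hxP, fun h => hxQ h.1⟩)
    replace hxQ : x ∉ Q := fun h => hxQ ⟨hxP, h⟩
    replace hyP : y ∉ P := fun h => hyP ⟨h, hyQ⟩
    set D := X ∩ ((P ⊓ Q : Subgroup G) : Set G) with hD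
    have hDP : Subgroup.closure D ≤ P := (Subgroup.closure_le _).mpr fun z hz => hz.2.1
    have hn : Subgroup.closure {x, y} ≤ Subgroup.normalizer (Subgroup.closure D : Set G) := by
      rw [Subgroup.closure_le]
      refine Set.Subset.trans ?_ (Subgroup.normalizer_le_normalizer_closure D)
      rintro z (rfl | rfl)
      exacts [hxn, hyn]
    obtain ⟨R, hR⟩ := (IsPGroup.to_sup_of_normal_right' (hp x hx y hy)
      (P.isPGroup'.to_le hDP) hn).exists_le_sylow
    have hxR : x ∈ R := hR (Subgroup.mem_sup_left (Subgroup.subset_closure (by simp)))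
    have hyR : y ∈ R := hR (Subgroup.mem_sup_left (Subgroup.subset_closure (by simp)))
    have hDR : ∀ z ∈ D, z ∈ R := fun z hz =>
      hR (Subgroup.mem_sup_right (Subgroup.subset_closure hz))
    -- `R` meets `P` and `Q` in more elements of `X` than they meet each other
    have hPR : ∀ z ∈ X, z ∈ P → z ∈ R := by
      by_contra! h
      refine (hmax (P, R) h).not_gt (Set.ncard_lt_ncard ⟨?_, ?_⟩ (Set.toFinite _))
      · exact fun z hz => ⟨hz.1, hz.2.1, hDR z hz⟩
      · exact fun hs => hxQ (hs ⟨hx, hxP, hxR⟩).2.2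
    have hRQ : ∀ z ∈ X, z ∈ R → z ∈ Q := by
      by_contra! h
      refine (hmax (R, Q) h).not_gt (Set.ncard_lt_ncard ⟨?_, ?_⟩ (Set.toFinite _))
      · exact fun z hz => ⟨hz.1, hDR z hz, hz.2.2⟩
      · exact fun hs => hyP (hs ⟨hy, hyR, hyQ⟩).2.1
    exact hxQ (hRQ x hx (hPR x hx hxP))
  have P : Sylow p G := default
  refine P.isPGroup'.to_le ((Subgroup.closure_le _).mpr fun x hx => ?_)
  obtain ⟨Q, hQ⟩ := (hp x hx x hx).exists_le_sylow
  exact hall Q P x hx (hQ (Subgroup.subset_closure (by simp)))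

theorem Group.IsNilpotent.exists_isPGroup {G : Type*} [Group G] [Finite G]
    [Group.IsNilpotent G] (p : ℕ) [Fact p.Prime] : ∃ P : Subgroup G, P.Normal ∧ IsPGroup p P ∧
      ∀ x : G, ∀ k : ℕ, x ^ p ^ k = 1 → x ∈ P := by
  have P : Sylow p G := default
  refine ⟨P, inferInstance, P.isPGroup', fun x k hx => ?_⟩
  have hz : IsPGroup p (Subgroup.zpowers x) := by
    rintro ⟨y, hy⟩
    obtain ⟨n, rfl⟩ := Subgroup.mem_zpowers_iff.mp hy
    refine ⟨k, Subtype.ext ?_⟩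
    change (x ^ n) ^ p ^ k = 1
    rw [← zpow_natCast, ← zpow_mul, mul_comm, zpow_mul, zpow_natCast, hx, one_zpow]
  obtain ⟨Q, hQ⟩ := hz.exists_le_sylow
  have := Sylow.unique_of_normal P inferInstance
  rw [Subsingleton.elim P Q]
  exact hQ (Subgroup.mem_zpowers x)

/-- An element of finite order is a product of its powers of prime power order. -/
theorem Subgroup.mem_iSup_closure_primePower {G : Type*} [Group G] [Finite G] {X : Set G} {x : G}
    (hx : x ∈ X) : x ∈ ⨆ p : (Nat.card G).primeFactors, Subgroup.closure
      {g : G | (∃ x ∈ X, g ∈ Subgroup.zpowers x) ∧ ∃ k, g ^ (p : ℕ) ^ k = 1} := by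
  have main : ∀ n : ℕ, n ∣ Nat.card G → ∀ y ∈ Subgroup.zpowers x, y ^ n = 1 →
      y ∈ ⨆ p : (Nat.card G).primeFactors, Subgroup.closure
        {g : G | (∃ x ∈ X, g ∈ Subgroup.zpowers x) ∧ ∃ k, g ^ (p : ℕ) ^ k = 1} := by
    intro n
    induction n using Nat.recOnPosPrimePosCoprime with
    | prime_pow p k hp hk =>
      intro hd y hy hyn
      have hpm : p ∈ (Nat.card G).primeFactors := by
        rw [Nat.mem_primeFactors]
        exact ⟨hp, (dvd_pow_self p hk.ne').trans hd, Nat.card_pos.ne'⟩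
      refine Subgroup.mem_iSup_of_mem ⟨p, hpm⟩ (Subgroup.subset_closure ?_)
      exact ⟨⟨x, hx, hy⟩, k, hyn⟩
    | zero =>
      intro hd
      exact absurd (zero_dvd_iff.mp hd) Nat.card_pos.ne'
    | one =>
      intro _ y _ hy
      rw [pow_one] at hy
      rw [hy]
      exact one_mem _
    | coprime a b _ _ hab ha hb =>
      intro hd y hy hyn
      have h1 := ha ((dvd_mul_right a b).trans hd) (y ^ b) (pow_mem hy b)
        (by rw [← pow_mul, mul_comm, hyn])
      have h2 := hb ((dvd_mul_left b a).trans hd) (y ^ a) (pow_mem hy a)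
        (by rw [← pow_mul, hyn])
      have h3 : y = (y ^ a) ^ (Nat.gcdA a b) * (y ^ b) ^ (Nat.gcdB a b) := by
        rw [← zpow_natCast, ← zpow_natCast, ← zpow_mul, ← zpow_mul, ← zpow_add,
          ← Nat.gcd_eq_gcd_ab, hab, Nat.cast_one, zpow_one]
      rw [h3]
      exact mul_mem (zpow_mem h2 _) (zpow_mem h1 _)
  exact main _ dvd_rfl x (Subgroup.mem_zpowers x) pow_card_eq_one'

/-- In a finite group, if any two elements of a conjugation-invariant set lie in a common
nilpotent subgroup, the set generates a nilpotent subgroup. -/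
theorem Group.IsNilpotent.closure_of_pairs {G : Type*} [Group G] [Finite G] {X : Set G}
    (hX : ∀ g, ∀ x ∈ X, g * x * g⁻¹ ∈ X)
    (hn : ∀ x ∈ X, ∀ y ∈ X, ∃ K : Subgroup G, x ∈ K ∧ y ∈ K ∧ Group.IsNilpotent K) :
    Group.IsNilpotent (Subgroup.closure X) := by
  set Y : ℕ → Set G := fun p => {g : G | (∃ x ∈ X, g ∈ Subgroup.zpowers x) ∧ ∃ k, g ^ p ^ k = 1}
  have hY : ∀ p g, ∀ x ∈ Y p, g * x * g⁻¹ ∈ Y p := by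
    rintro p g y ⟨⟨x, hx, n, rfl⟩, k, hk⟩
    refine ⟨⟨g * x * g⁻¹, hX g x hx, n, conj_zpow⟩, k, ?_⟩
    rw [conj_pow, hk, mul_one, mul_inv_cancel]
  have hYn : ∀ {p q : ℕ} {x y : G}, x ∈ Y p → y ∈ Y q →
      ∃ K : Subgroup G, x ∈ K ∧ y ∈ K ∧ Group.IsNilpotent K := by
    rintro p q x y ⟨⟨a, ha, hxa⟩, -⟩ ⟨⟨b, hb, hyb⟩, -⟩
    obtain ⟨K, haK, hbK, hK⟩ := hn a ha b hb
    exact ⟨K, (Subgroup.zpowers_le.mpr haK) hxa, (Subgroup.zpowers_le.mpr hbK) hyb, hK⟩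
  have hpg : ∀ p, p.Prime → IsPGroup p (Subgroup.closure (Y p)) := by
    intro p hp
    have : Fact p.Prime := ⟨hp⟩
    refine IsPGroup.closure_of_pairs (hY p) fun x hx y hy => ?_
    obtain ⟨K, hxK, hyK, hK⟩ := hYn hx hy
    obtain ⟨P, -, hP, hmem⟩ := Group.IsNilpotent.exists_isPGroup (G := K) p
    obtain ⟨-, k, hk⟩ := hx
    obtain ⟨-, l, hl⟩ := hy
    refine (hP.map K.subtype).to_le ((Subgroup.closure_le _).mpr ?_)
    rintro z (rfl | rfl)
    · exact ⟨⟨z, hxK⟩, hmem _ k (Subtype.ext hk), rfl⟩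
    · exact ⟨⟨z, hyK⟩, hmem _ l (Subtype.ext hl), rfl⟩
  have hcomm : ∀ p q, p.Prime → q.Prime → p ≠ q → ∀ x ∈ Subgroup.closure (Y p),
      ∀ y ∈ Subgroup.closure (Y q), Commute x y := by
    intro p q hp hq hpq
    have : Fact p.Prime := ⟨hp⟩
    have : Fact q.Prime := ⟨hq⟩
    have h0 : ∀ x ∈ Y p, ∀ y ∈ Y q, Commute x y := by
      intro x hx y hy
      obtain ⟨K, hxK, hyK, hK⟩ := hYn hx hy
      obtain ⟨P, hPn, hP, hPm⟩ := Group.IsNilpotent.exists_isPGroup (G := K) p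
      obtain ⟨R, hRn, hR, hRm⟩ := Group.IsNilpotent.exists_isPGroup (G := K) q
      obtain ⟨-, k, hk⟩ := hx
      obtain ⟨-, l, hl⟩ := hy
      have := Subgroup.commute_of_normal_of_disjoint P R hPn hRn
        (IsPGroup.disjoint_of_ne p q hpq P R hP hR) ⟨x, hxK⟩ ⟨y, hyK⟩
        (hPm _ k (Subtype.ext hk)) (hRm _ l (Subtype.ext hl))
      exact congrArg Subtype.val this
    have h1 : Subgroup.closure (Y p) ≤ Subgroup.centralizer (Y q) :=
      (Subgroup.closure_le _).mpr fun x hx =>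
        Subgroup.mem_centralizer_iff.mpr fun y hy => (h0 x hx y hy).symm
    intro x hx y hy
    have h2 : Subgroup.closure (Y q) ≤ Subgroup.centralizer {x} :=
      (Subgroup.closure_le _).mpr fun y hy => Subgroup.mem_centralizer_iff.mpr fun z hz => by
        rw [Set.mem_singleton_iff.mp hz]
        exact (Subgroup.mem_centralizer_iff.mp (h1 hx) y hy).symm
    exact Subgroup.mem_centralizer_iff.mp (h2 hy) x rfl
  have hcomm' : Pairwise fun i j : (Nat.card G).primeFactors => ∀ x y : G,
      x ∈ Subgroup.closure (Y i) → y ∈ Subgroup.closure (Y j) → Commute x y :=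
    fun i j hij x y hx hy => hcomm i j (Nat.prime_of_mem_primeFactors i.2)
      (Nat.prime_of_mem_primeFactors j.2) (fun h => hij (Subtype.ext h)) x hx y hy
  have hnil : ∀ i : (Nat.card G).primeFactors, Group.IsNilpotent (Subgroup.closure (Y i)) := by
    intro i
    have : Fact (i : ℕ).Prime := ⟨Nat.prime_of_mem_primeFactors i.2⟩
    exact (hpg i this.out).isNilpotent
  have hrange : Group.IsNilpotent (Subgroup.noncommPiCoprod hcomm').range :=
    Group.nilpotent_of_surjective _ (Subgroup.noncommPiCoprod hcomm').rangeRestrict_surjective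
  have hle : Subgroup.closure X ≤ (Subgroup.noncommPiCoprod hcomm').range := by
    rw [Subgroup.noncommPiCoprod_range, Subgroup.closure_le]
    exact fun x hx => Subgroup.mem_iSup_closure_primePower hx
  exact Group.nilpotent_of_mulEquiv (Subgroup.subgroupOfEquivOfLe hle)

/-! ### The order of a distributive Mendelsohn quasigroup -/

/-- In a transitive action of a finite group, the orbits of a normal Sylow `q`-subgroup have the
`q`-part of the number of points as their cardinality. -/
theorem MulAction.ncard_orbit_sylow {G Q : Type*} [Group G] [Finite G] [MulAction G Q]
    [MulAction.IsPretransitive G Q] {q : ℕ} [Fact q.Prime] (P : Sylow q G) [P.Normal] (e : Q) :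
    ∃ k m, ¬ q ∣ m ∧ Nat.card Q = q ^ k * m ∧ (MulAction.orbit P e).ncard = q ^ k := by
  set H := MulAction.stabilizer G e with hH
  have hcard : H.index = Nat.card Q := by
    rw [MulAction.index_stabilizer, MulAction.orbit_eq_univ, Set.ncard_univ]
  have horb : (MulAction.orbit P e).ncard = H.relIndex P := by
    rw [← MulAction.index_stabilizer]
    rfl
  obtain ⟨k, hk⟩ := P.isPGroup'.index (MulAction.stabilizer P e)
  rw [MulAction.index_stabilizer] at hk
  -- the second isomorphism theorem: `[HP : H] = [P : H ∩ P]`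
  have hsup : H.relIndex (H ⊔ P) = H.relIndex P := by
    have h1 := Subgroup.relIndex_mul_relIndex (H ⊓ P) H (H ⊔ P) inf_le_left le_sup_left
    have h2 := Subgroup.relIndex_mul_relIndex (H ⊓ P) P (H ⊔ P) inf_le_right le_sup_right
    rw [Subgroup.inf_relIndex_left] at h1
    rw [Subgroup.inf_relIndex_right, Subgroup.relIndex_sup_right] at h2
    rw [← h2, mul_comm] at h1
    exact Nat.eq_of_mul_eq_mul_right (Nat.pos_of_ne_zero Subgroup.FiniteIndex.index_ne_zero) h1
  refine ⟨k, (H ⊔ P : Subgroup G).index, fun hd => P.not_dvd_index ?_, ?_, hk⟩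
  · exact hd.trans (Subgroup.index_dvd_of_le le_sup_right)
  · rw [← hcard, ← Subgroup.relIndex_mul_index (le_sup_left : H ≤ H ⊔ P), hsup, ← horb, hk]

/-- A finite Mendelsohn quasigroup has order `0` or `1` modulo `3`. -/
theorem sq_card_modEq_card_of_semisymm {B : Type*} [Finite B] (op : B → B → B)
    (idem : ∀ x, op x x = x) (h1 : ∀ x y, op x (op y x) = y) (h2 : ∀ x y, op (op x y) x = y) :
    Nat.card B ^ 2 ≡ Nat.card B [MOD 3] := by
  classical
  have := Fintype.ofFinite B
  have : Fact (Nat.Prime 3) := ⟨Nat.prime_three⟩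
  -- the map rotating the blocks `⟨x, y, x ∘ y⟩` fixes exactly the diagonal
  let f : Function.End (B × B) := fun a => (a.2, op a.1 a.2)
  have hf : f ^ 3 ^ 1 = 1 := by
    funext ⟨x, y⟩
    change f (f (f (x, y))) = (x, y)
    simp only [f, h1, h2]
  have h := Equiv.Perm.card_fixedPoints_modEq hf
  have hfix : Fintype.card (Function.fixedPoints f) = Fintype.card B := by
    refine Fintype.card_congr ⟨fun a => a.1.1, fun b => ⟨(b, b), ?_⟩, ?_, fun b => rfl⟩
    · change f (b, b) = (b, b)
      simp only [f, idem]
    · rintro ⟨⟨x, y⟩, hxy⟩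
      have : y = x := congrArg Prod.fst hxy
      subst this
      rfl
  rw [hfix, Fintype.card_prod] at h
  rwa [Nat.card_eq_fintype_card, sq]

namespace IsMendelsohnQuasigroup

variable {Q : Type*} {op : Q → Q → Q}

/-- The left translation `y ↦ x ∘ y`. -/
noncomputable def leftTranslation (hM : IsMendelsohnQuasigroup op) (x : Q) : Equiv.Perm Q :=
  Equiv.ofBijective _ (hM.bijective_left x)

theorem op_op_left (hM : IsMendelsohnQuasigroup op) (x y : Q) : op (op x y) x = y :=
  (hM.bijective_left x).1 (hM.semisymm x (op x y))

/-- The group generated by the left translations. -/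
def multGroup (hM : IsMendelsohnQuasigroup op) : Subgroup (Equiv.Perm Q) :=
  Subgroup.closure (Set.range hM.leftTranslation)

/-- The left translation by `x`, as an element of the group generated by all of them. -/
noncomputable def translation (hM : IsMendelsohnQuasigroup op) (x : Q) : hM.multGroup :=
  ⟨hM.leftTranslation x, Subgroup.subset_closure ⟨x, rfl⟩⟩

theorem translation_smul (hM : IsMendelsohnQuasigroup op) (x y : Q) :
    hM.translation x • y = op x y := rfl

theorem smul_op (hM : IsMendelsohnQuasigroup op) (hD : IsDistributiveOp op) (g : hM.multGroup)
    (x y : Q) : g • op x y = op (g • x) (g • y) := by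
  obtain ⟨g, hg⟩ := g
  change g (op x y) = op (g x) (g y)
  induction hg using Subgroup.closure_induction generalizing x y with
  | mem g hg => obtain ⟨a, rfl⟩ := hg; exact hD.left_distrib a x y
  | one => rfl
  | mul g h _ _ hg hh => simp only [Equiv.Perm.mul_apply, hg, hh]
  | inv g _ hg =>
    apply g.injective
    simp [hg]

theorem conj_translation (hM : IsMendelsohnQuasigroup op) (hD : IsDistributiveOp op)
    (g : hM.multGroup) (x : Q) :
    g * hM.translation x * g⁻¹ = hM.translation (g • x) := by
  refine Subtype.ext (Equiv.ext fun y => ?_)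
  change (g * hM.translation x * g⁻¹) • y = hM.translation (g • x) • y
  rw [mul_smul, mul_smul, translation_smul, hM.smul_op hD, smul_inv_smul, translation_smul]

theorem isBraidSet (hM : IsMendelsohnQuasigroup op) (hD : IsDistributiveOp op) :
    IsBraidSet (Set.range hM.translation) where
  conj_mem := by
    rintro _ _ ⟨x, rfl⟩ ⟨y, rfl⟩
    exact ⟨_, (hM.conj_translation hD _ y).symm⟩
  braid := by
    rintro _ _ ⟨x, rfl⟩ ⟨y, rfl⟩
    -- conjugating the translation by `x` first by that of `y` and then by that of `x` gives the
    -- translation by `x ∘ (y ∘ x) = y`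
    have h1 := hM.conj_translation hD (hM.translation y) x
    have h2 := hM.conj_translation hD (hM.translation x) (op y x)
    rw [translation_smul] at h1 h2
    rw [hM.semisymm, ← h1] at h2
    rw [mul_inv_eq_iff_eq_mul, ← mul_assoc, ← mul_assoc, mul_inv_eq_iff_eq_mul] at h2
    exact h2
  eq_one := by
    intro g hg
    refine Subtype.ext (Equiv.ext fun x => ?_)
    change g • x = x
    have h := hM.conj_translation hD g x
    rw [(hg _ ⟨x, rfl⟩).eq, mul_inv_cancel_right] at h
    have h' : op x (g • x) = op (g • x) (g • x) := by
      rw [← translation_smul hM x, h, translation_smul]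
    exact ((hM.bijective_right (g • x)).1 h').symm

/-- The displacement group of a finite distributive Mendelsohn quasigroup is nilpotent. -/
theorem isNilpotent_displacement [Finite Q] (hM : IsMendelsohnQuasigroup op)
    (hD : IsDistributiveOp op) : Group.IsNilpotent (Subgroup.closure
      {g | ∃ x y, hM.translation x * (hM.translation y)⁻¹ = g}) := by
  refine Group.IsNilpotent.closure_of_pairs ?_ ?_
  · rintro g _ ⟨x, y, rfl⟩
    refine ⟨g • x, g • y, ?_⟩
    rw [← hM.conj_translation hD, ← hM.conj_translation hD]
    group
  · rintro _ ⟨x, y, rfl⟩ _ ⟨w, z, rfl⟩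
    generalize hX : hM.translation x = X
    generalize hY : hM.translation y = Y
    generalize hZ : hM.translation z = Z
    generalize hW : hM.translation w = W
    have hT := (hM.isBraidSet hD).isDisplacementSet ⟨z, hZ⟩
    have hN := hT.isNilpotent_closure (p := Z⁻¹ * X) (q := Z⁻¹ * Y) (r := Z⁻¹ * W)
      ⟨X, ⟨x, hX⟩, rfl⟩ ⟨Y, ⟨y, hY⟩, rfl⟩ ⟨W, ⟨w, hW⟩, rfl⟩
    set N := Subgroup.closure {Z⁻¹ * X, Z⁻¹ * Y, Z⁻¹ * W} with hNdef
    have hp : Z⁻¹ * X ∈ N := Subgroup.subset_closure (by simp)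
    have hq : Z⁻¹ * Y ∈ N := Subgroup.subset_closure (by simp)
    have hr : Z⁻¹ * W ∈ N := Subgroup.subset_closure (by simp)
    refine ⟨N.map (MulAut.conj Z).toMonoidHom, ⟨_, N.mul_mem hp (N.inv_mem hq), ?_⟩,
      ⟨_, hr, ?_⟩, ?_⟩
    · simp only [MulEquiv.toMonoidHom_eq_coe, MonoidHom.coe_coe, MulAut.conj_apply]
      group
    · simp only [MulEquiv.toMonoidHom_eq_coe, MonoidHom.coe_coe, MulAut.conj_apply]
      group
    · exact Group.nilpotent_of_surjective _ (MonoidHom.subgroupMap_surjective _ N)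

/-- The exponent of a prime `q ≡ 2 [MOD 3]` in the order of a distributive Mendelsohn quasigroup is
even: an orbit of the Sylow `q`-subgroup of the displacement group is a subquasigroup whose order
is the `q`-part of the order of `Q`. -/
theorem even_factorization_card [Finite Q] [Nonempty Q] (hM : IsMendelsohnQuasigroup op)
    (hD : IsDistributiveOp op) {q : ℕ} (hq : q.Prime) (hq2 : q ≡ 2 [MOD 3]) :
    Even ((Nat.card Q).factorization q) := by
  have : Fact q.Prime := ⟨hq⟩
  obtain ⟨e⟩ := ‹Nonempty Q›
  set X : Set hM.multGroup := {g | ∃ x y, hM.translation x * (hM.translation y)⁻¹ = g} with hXdef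
  have hnil : Group.IsNilpotent (Subgroup.closure X) := hM.isNilpotent_displacement hD
  have hNn : (Subgroup.closure X).Normal := by
    rw [← Subgroup.normalizer_eq_top_iff, eq_top_iff]
    refine le_trans ?_ (Subgroup.normalizer_le_normalizer_closure X)
    have hX : ∀ g, ∀ x ∈ X, g * x * g⁻¹ ∈ X := by
      rintro g _ ⟨x, y, rfl⟩
      refine ⟨g • x, g • y, ?_⟩
      rw [← hM.conj_translation hD, ← hM.conj_translation hD]
      group
    intro g _
    rw [Subgroup.mem_set_normalizer_iff]
    refine fun h => ⟨hX g h, fun hh => ?_⟩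
    have := hX g⁻¹ _ hh
    rwa [show g⁻¹ * (g * h * g⁻¹) * g⁻¹⁻¹ = h by group] at this
  have htr : MulAction.IsPretransitive (Subgroup.closure X) Q := by
    refine ⟨fun a b => ?_⟩
    obtain ⟨x, hx⟩ := (hM.bijective_right a).2 b
    refine ⟨⟨_, Subgroup.subset_closure ⟨x, a, rfl⟩⟩, ?_⟩
    change (hM.translation x * (hM.translation a)⁻¹) • a = b
    rw [mul_smul,
      inv_smul_eq_iff.mpr (by rw [translation_smul, hM.idem] : a = hM.translation a • a)]
    exact hx
  have P : Sylow q (Subgroup.closure X) := default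
  have hPc : (P : Subgroup (Subgroup.closure X)).Characteristic :=
    P.characteristic_of_normal inferInstance
  obtain ⟨k, m, hm, hcard, horb⟩ := MulAction.ncard_orbit_sylow P e
  -- normality of `S` in the whole group of translations makes the orbit a subquasigroup
  have hS : ((P : Subgroup (Subgroup.closure X)).map (Subgroup.closure X).subtype).Normal :=
    ConjAct.normal_of_characteristic_of_normal
  set S := (P : Subgroup (Subgroup.closure X)).map (Subgroup.closure X).subtype with hSdef
  have horbS : ∀ b, b ∈ MulAction.orbit P e ↔ ∃ g ∈ S, g • e = b := by
    intro b
    constructor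
    · rintro ⟨g, rfl⟩
      exact ⟨_, ⟨g, g.2, rfl⟩, rfl⟩
    · rintro ⟨_, ⟨g, hg, rfl⟩, rfl⟩
      exact ⟨⟨g, hg⟩, rfl⟩
  have hclosed : ∀ b ∈ MulAction.orbit P e, ∀ c ∈ MulAction.orbit P e,
      op b c ∈ MulAction.orbit P e := by
    simp only [horbS]
    rintro _ ⟨g, hg, rfl⟩ _ ⟨h, hh, rfl⟩
    refine ⟨g * (hM.translation e * (g⁻¹ * h) * (hM.translation e)⁻¹),
      S.mul_mem hg (hS.conj_mem _ (S.mul_mem (S.inv_mem hg) hh) _), ?_⟩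
    have he : (hM.translation e)⁻¹ • e = e := by
      rw [inv_smul_eq_iff, translation_smul, hM.idem]
    rw [mul_smul, mul_smul, he, mul_smul, mul_smul, translation_smul, hM.smul_op hD,
      smul_inv_smul]
  have h3 := sq_card_modEq_card_of_semisymm (B := MulAction.orbit P e)
    (fun x y => ⟨op x y, hclosed _ x.2 _ y.2⟩) (fun x => Subtype.ext (hM.idem x))
    (fun x y => Subtype.ext (hM.semisymm x y)) (fun x y => Subtype.ext (hM.op_op_left x y))
  rw [Nat.card_coe_set_eq, horb] at h3
  have hm0 : m ≠ 0 := fun h => hm (h ▸ dvd_zero q)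
  rw [hcard, Nat.factorization_mul (pow_ne_zero _ hq.ne_zero) hm0, Finsupp.add_apply,
    hq.factorization_pow, Finsupp.single_eq_same, Nat.factorization_eq_zero_of_not_dvd hm, add_zero]
  by_contra hk
  obtain ⟨j, rfl⟩ := Nat.not_even_iff_odd.mp hk
  have h4 : q ^ (2 * j + 1) ≡ 2 [MOD 3] := by
    have : (q ^ 2) ^ j * q ≡ 1 ^ j * 2 [MOD 3] :=
      (((hq2.pow 2).trans (by decide : 2 ^ 2 ≡ 1 [MOD 3])).pow j).mul hq2
    rwa [← pow_mul, ← pow_succ, one_pow, one_mul] at this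
  have h5 : 4 ≡ 2 [MOD 3] := ((h4.pow 2).symm.trans h3).trans h4
  exact absurd h5 (by decide)

end IsMendelsohnQuasigroup

/-! ### Loeschian numbers and affine quasigroups -/

theorem IsLoeschian.of_int {n : ℕ} {x y : ℤ} (h : (n : ℤ) = x ^ 2 + x * y + y ^ 2) :
    IsLoeschian n := by
  -- if `x` and `y` have opposite signs, replace `(a, -b)` by `(a - b, b)` or `(a, b - a)`
  have main : ∀ a b : ℕ, (n : ℤ) = (a : ℤ) ^ 2 - a * b + (b : ℤ) ^ 2 → IsLoeschian n := by
    intro a b hab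
    rcases le_total a b with hle | hle
    · obtain ⟨c, rfl⟩ := Nat.exists_eq_add_of_le hle
      refine ⟨a, c, ?_⟩
      push_cast at hab
      zify
      rw [hab]
      ring
    · obtain ⟨c, rfl⟩ := Nat.exists_eq_add_of_le hle
      refine ⟨b, c, ?_⟩
      push_cast at hab
      zify
      rw [hab]
      ring
  obtain ⟨a, rfl | rfl⟩ := x.eq_nat_or_neg <;> obtain ⟨b, rfl | rfl⟩ := y.eq_nat_or_neg
  · exact ⟨a, b, by exact_mod_cast h⟩
  · exact main a b (by rw [h]; ring)
  · exact main a b (by rw [h]; ring)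
  · exact ⟨a, b, by zify; rw [h]; ring⟩

theorem IsLoeschian.mul {m n : ℕ} (hm : IsLoeschian m) (hn : IsLoeschian n) :
    IsLoeschian (m * n) := by
  obtain ⟨a, b, rfl⟩ := hm
  obtain ⟨c, d, rfl⟩ := hn
  -- multiplicativity of the norm of `ℤ[η]` with `η ^ 2 = η - 1`
  refine IsLoeschian.of_int (x := a * c - b * d) (y := a * d + b * c + b * d) ?_
  push_cast
  ring

theorem IsLoeschian.pow {m : ℕ} (hm : IsLoeschian m) (k : ℕ) : IsLoeschian (m ^ k) := by
  induction k with
  | zero => exact ⟨1, 0, rfl⟩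
  | succ k ih => rw [pow_succ]; exact ih.mul hm

/-- **Thue's lemma**. -/
theorem ZMod.exists_eq_mul_of_sqrt {p : ℕ} [NeZero p] (w : ZMod p) :
    ∃ x y : ℤ, (x ≠ 0 ∨ y ≠ 0) ∧ |x| ≤ Nat.sqrt p ∧ |y| ≤ Nat.sqrt p ∧ (x : ZMod p) = w * y := by
  classical
  have hcard : Fintype.card (ZMod p) <
      Fintype.card (Fin (Nat.sqrt p + 1) × Fin (Nat.sqrt p + 1)) := by
    rw [ZMod.card, Fintype.card_prod, Fintype.card_fin]
    exact Nat.lt_succ_sqrt p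
  obtain ⟨⟨i, j⟩, ⟨i', j'⟩, hne, heq⟩ := Fintype.exists_ne_map_eq_of_card_lt
    (fun a : Fin (Nat.sqrt p + 1) × Fin (Nat.sqrt p + 1) =>
      ((a.1 : ℕ) : ZMod p) - w * ((a.2 : ℕ) : ZMod p)) hcard
  refine ⟨(i : ℕ) - (i' : ℕ), (j : ℕ) - (j' : ℕ), ?_, ?_, ?_, ?_⟩
  · by_contra! h
    refine hne (Prod.ext (Fin.ext ?_) (Fin.ext ?_)) <;> simp only <;> omega
  · rw [abs_le]; omega
  · rw [abs_le]; omega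
  · push_cast
    simp only at heq
    linear_combination heq

theorem ZMod.exists_sq_add_self_add_one {p : ℕ} [Fact p.Prime] (hp : p ≡ 1 [MOD 3]) :
    ∃ w : ZMod p, w ^ 2 + w + 1 = 0 := by
  have : Fact (Nat.Prime 3) := ⟨Nat.prime_three⟩
  have hd : 3 ∣ Fintype.card (ZMod p)ˣ := by
    rw [ZMod.card_units]
    exact (Nat.modEq_iff_dvd' (Fact.out : p.Prime).one_le).mp hp.symm
  obtain ⟨w, hw⟩ := exists_prime_orderOf_dvd_card 3 hd
  refine ⟨w, ?_⟩
  have h3 : (w : ZMod p) ^ 3 = 1 := by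
    rw [← Units.val_pow_eq_pow_val, ← hw, pow_orderOf_eq_one, Units.val_one]
  have h1 : (w : ZMod p) - 1 ≠ 0 := by
    rw [sub_ne_zero]
    intro h
    rw [Units.val_eq_one] at h
    rw [h, orderOf_one] at hw
    omega
  apply mul_left_cancel₀ h1
  linear_combination h3

theorem IsLoeschian.of_prime {p : ℕ} (hp : p.Prime) (hp1 : p ≡ 1 [MOD 3]) : IsLoeschian p := by
  have : Fact p.Prime := ⟨hp⟩
  obtain ⟨w, hw⟩ := ZMod.exists_sq_add_self_add_one hp1
  obtain ⟨x, y, hne, hx, hy, hxy⟩ := ZMod.exists_eq_mul_of_sqrt w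
  have hd : (p : ℤ) ∣ x ^ 2 + x * y + y ^ 2 := by
    rw [← ZMod.intCast_zmod_eq_zero_iff_dvd]
    push_cast
    rw [hxy]
    linear_combination (y : ZMod p) ^ 2 * hw
  obtain ⟨c, hc⟩ := hd
  have hk : ((Nat.sqrt p : ℕ) : ℤ) ^ 2 < p := by
    have h1 : Nat.sqrt p ^ 2 ≤ p := Nat.sqrt_le' p
    have h2 : Nat.sqrt p ^ 2 ≠ p := fun h => hp.prime.irreducible.not_isSquare ⟨_, by rw [← sq, h]⟩
    exact_mod_cast lt_of_le_of_ne h1 h2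
  have hx2 : x ^ 2 ≤ (Nat.sqrt p : ℤ) ^ 2 := sq_le_sq' (abs_le.mp hx).1 (abs_le.mp hx).2
  have hy2 : y ^ 2 ≤ (Nat.sqrt p : ℤ) ^ 2 := sq_le_sq' (abs_le.mp hy).1 (abs_le.mp hy).2
  have hlt : x ^ 2 + x * y + y ^ 2 < 3 * p := by nlinarith [sq_nonneg (x - y)]
  have hpos : 0 < x ^ 2 + x * y + y ^ 2 := by
    rcases hne with h | h
    · nlinarith [sq_nonneg (x + 2 * y), sq_pos_of_ne_zero h]
    · nlinarith [sq_nonneg (2 * x + y), sq_pos_of_ne_zero h]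
  have hp0 : (0 : ℤ) < p := by exact_mod_cast hp.pos
  rw [hc] at hlt hpos
  have hc0 : 0 < c := pos_of_mul_pos_right hpos hp0.le
  have hc3 : c < 3 := by nlinarith
  obtain rfl | rfl : c = 1 ∨ c = 2 := by omega
  · exact IsLoeschian.of_int (x := x) (y := y) (by rw [hc, mul_one])
  · -- `x ^ 2 + x * y + y ^ 2` is even only if `x` and `y` are, and then it is divisible by `4`
    exfalso
    have hodd : p % 2 = 1 := by
      rcases hp.eq_two_or_odd with h | h
      · rw [h] at hp1; exact absurd hp1 (by decide)
      · exact h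
    obtain ⟨a, ha | ha⟩ := Int.even_or_odd' x <;> obtain ⟨b, hb | hb⟩ := Int.even_or_odd' y <;>
      subst ha <;> subst hb <;> ring_nf at hc <;> omega

/-- A number in which every prime `q ≡ 2 [MOD 3]` has an even exponent is Loeschian. -/
theorem IsLoeschian.of_even_factorization {n : ℕ} (hn : n ≠ 0)
    (h : ∀ q, q.Prime → q ≡ 2 [MOD 3] → Even (n.factorization q)) : IsLoeschian n := by
  induction n using Nat.recOnPosPrimePosCoprime with
  | prime_pow p k hp hk =>
    have hlt : p % 3 < 3 := Nat.mod_lt _ (by norm_num)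
    obtain h0 | h1 | h2 : p % 3 = 0 ∨ p % 3 = 1 ∨ p % 3 = 2 := by omega
    · have h3 : p = 3 := ((Nat.prime_dvd_prime_iff_eq Nat.prime_three hp).mp
        (Nat.dvd_of_mod_eq_zero h0)).symm
      subst h3
      exact IsLoeschian.pow ⟨1, 1, rfl⟩ k
    · exact (IsLoeschian.of_prime hp h1).pow k
    · have he := h p hp h2
      rw [hp.factorization_pow, Finsupp.single_eq_same] at he
      obtain ⟨j, rfl⟩ := he
      exact ⟨p ^ j, 0, by ring⟩
  | zero => exact absurd rfl hn
  | one => exact ⟨1, 0, rfl⟩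
  | coprime a b ha hb hab iha ihb =>
    have ha0 : a ≠ 0 := by omega
    have hb0 : b ≠ 0 := by omega
    have hf : ∀ q, (a * b).factorization q = a.factorization q + b.factorization q := fun q => by
      rw [Nat.factorization_mul ha0 hb0, Finsupp.add_apply]
    refine (iha ha0 fun q hq hq2 => ?_).mul (ihb hb0 fun q hq hq2 => ?_)
    · by_cases hqb : q ∣ b
      · rw [Nat.factorization_eq_zero_of_not_dvd fun hqa => Nat.not_coprime_of_dvd_of_dvd
          hq.one_lt hqa hqb hab]
        exact Even.zero
      · have := h q hq hq2
        rwa [hf, Nat.factorization_eq_zero_of_not_dvd hqb, add_zero] at this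
    · by_cases hqa : q ∣ a
      · rw [Nat.factorization_eq_zero_of_not_dvd fun hqb => Nat.not_coprime_of_dvd_of_dvd
          hq.one_lt hqa hqb hab]
        exact Even.zero
      · have := h q hq hq2
        rwa [hf, Nat.factorization_eq_zero_of_not_dvd hqa, zero_add] at this

theorem IsMendelsohnQuasigroup.of_semisymm {V : Type*} {op : V → V → V}
    (idem : ∀ x, op x x = x) (h1 : ∀ x y, op x (op y x) = y) (h2 : ∀ x y, op (op x y) x = y) :
    IsMendelsohnQuasigroup op where
  bijective_left a := Function.bijective_iff_has_inverse.mpr ⟨fun y => op y a, h2 a, h1 a⟩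
  bijective_right a := Function.bijective_iff_has_inverse.mpr ⟨fun y => op a y, h1 a, h2 a⟩
  idem := idem
  semisymm := h1

section Affine

variable {A : Type*} [AddCommGroup A] {α : A →+ A}

theorem isMendelsohnQuasigroup_affine (hα : ∀ a, α (α a) = α a - a) :
    IsMendelsohnQuasigroup (fun a b : A => a - α a + α b) := by
  refine .of_semisymm (fun x => ?_) (fun x y => ?_) (fun x y => ?_)
  · abel
  · simp only [map_add, map_sub, hα]; abel
  · simp only [map_add, map_sub, hα]; abel

theorem isDistributiveOp_affine : IsDistributiveOp (fun a b : A => a - α a + α b) := by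
  constructor <;> intros <;> simp only [map_add, map_sub] <;> abel

end Affine

/-- Every positive Loeschian number is the order of a distributive Mendelsohn quasigroup. For
`d = gcd x y` it is affine over the module `ZMod m × (ZMod d) ^ 2` of the Eisenstein integers, where
`m` is the norm belonging to the coprime pair `x / d`, `y / d`. -/
theorem IsLoeschian.exists_quasigroup {n : ℕ} (hn : n ≠ 0) (h : IsLoeschian n) :
    ∃ (Q : Type u) (op : Q → Q → Q),
      Nat.card Q = n ∧ IsMendelsohnQuasigroup op ∧ IsDistributiveOp op := by
  obtain ⟨x, y, rfl⟩ := h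
  have hxy : 0 < x ∨ 0 < y := by
    by_contra! hc
    obtain ⟨rfl, rfl⟩ : x = 0 ∧ y = 0 := by omega
    exact hn rfl
  have hg : 0 < Nat.gcd x y := by
    rcases hxy with h | h
    · exact Nat.gcd_pos_of_pos_left _ h
    · exact Nat.gcd_pos_of_pos_right _ h
  obtain ⟨d, a, b, hd, hab, rfl, rfl⟩ := Nat.exists_coprime' hg
  set m := a ^ 2 + a * b + b ^ 2 with hm
  have hb : Nat.Coprime b m := by
    rw [hm, show a ^ 2 + a * b + b ^ 2 = a ^ 2 + b * (a + b) by ring,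
      Nat.coprime_add_mul_left_right]
    exact hab.symm.pow_right 2
  -- `u = -a / b` is a root of `u ^ 2 - u + 1` modulo `m`
  set u : ZMod m := -a * ((ZMod.unitOfCoprime b hb)⁻¹ : (ZMod m)ˣ) with hu
  have hbu : (b : ZMod m) * u = -a := by
    have : (b : ZMod m) * ((ZMod.unitOfCoprime b hb)⁻¹ : (ZMod m)ˣ) = 1 := by
      rw [← ZMod.coe_unitOfCoprime b hb, Units.mul_inv]
    rw [hu]
    linear_combination (-(a : ZMod m)) * this
  have hu2 : u * u = u - 1 := by
    have hb1 : IsUnit (b : ZMod m) := ⟨ZMod.unitOfCoprime b hb, ZMod.coe_unitOfCoprime b hb⟩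
    have hm0 : (a : ZMod m) ^ 2 + a * b + (b : ZMod m) ^ 2 = 0 := by
      have := ZMod.natCast_self m
      rw [hm] at this
      push_cast at this
      rwa [← hm] at this
    apply (hb1.pow 2).mul_left_cancel
    linear_combination (b * u - a - b) * hbu + hm0
  -- multiplication by a root of `X ^ 2 - X + 1`, on `(ZMod d) ^ 2` given by its companion matrix
  let α : (ZMod m × ZMod d × ZMod d) →+ (ZMod m × ZMod d × ZMod d) :=
    { toFun := fun t => (u * t.1, -t.2.2, t.2.1 + t.2.2)
      map_zero' := by simp
      map_add' := fun s t => by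
        simp only [Prod.fst_add, Prod.snd_add, Prod.mk_add_mk, Prod.mk.injEq]
        exact ⟨by ring, by ring, by ring⟩ }
  have hα : ∀ t, α (α t) = α t - t := by
    rintro ⟨r, s, t⟩
    simp only [α, AddMonoidHom.coe_mk, ZeroHom.coe_mk, Prod.mk_sub_mk, Prod.mk.injEq]
    refine ⟨?_, by ring, by ring⟩
    rw [← mul_assoc, hu2]
    ring
  let β : ULift.{u} (ZMod m × ZMod d × ZMod d) →+ ULift.{u} (ZMod m × ZMod d × ZMod d) :=
    AddEquiv.ulift.symm.toAddMonoidHom.comp (α.comp AddEquiv.ulift.toAddMonoidHom)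
  refine ⟨ULift.{u} (ZMod m × ZMod d × ZMod d), _, ?_, isMendelsohnQuasigroup_affine (α := β)
    fun t => congrArg ULift.up (hα t.down), isDistributiveOp_affine⟩
  rw [Nat.card_ulift, Nat.card_prod, Nat.card_prod, Nat.card_zmod, Nat.card_zmod, hm]
  ring

/-! ### Mendelsohn triple systems and the existence spectrum -/

namespace MendelsohnTripleSystem

variable {V : Type*}

theorem op_op_right (M : MendelsohnTripleSystem V) (x y : V) : M.op x (M.op y x) = y := by
  rcases eq_or_ne y x with rfl | h
  · rw [M.op_self, M.op_self]
  · obtain ⟨z, hz⟩ := M.exists_third h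
    rw [M.op_eq_of_mem hz]
    refine M.op_eq_of_mem ?_
    rwa [show (([x, z, y] : List V) : Cycle V) = ([y, x, z] : List V) from
      Cycle.coe_eq_coe.mpr ⟨2, rfl⟩]

theorem op_op_left (M : MendelsohnTripleSystem V) (x y : V) : M.op (M.op x y) x = y := by
  rcases eq_or_ne x y with rfl | h
  · rw [M.op_self, M.op_self]
  · obtain ⟨z, hz⟩ := M.exists_third h
    rw [M.op_eq_of_mem hz]
    refine M.op_eq_of_mem ?_
    rwa [show (([z, x, y] : List V) : Cycle V) = ([x, y, z] : List V) from
      Cycle.coe_eq_coe.mpr ⟨1, rfl⟩]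

theorem isMendelsohnQuasigroup (M : MendelsohnTripleSystem V) : IsMendelsohnQuasigroup M.op :=
  .of_semisymm M.op_self M.op_op_right M.op_op_left

end MendelsohnTripleSystem

/-- The Mendelsohn triple system of a Mendelsohn quasigroup, with the blocks `⟨x, y, x ∘ y⟩`. -/
def IsMendelsohnQuasigroup.tripleSystem {V : Type*} {op : V → V → V}
    (hM : IsMendelsohnQuasigroup op) : MendelsohnTripleSystem V where
  blocks := {C | ∃ x y, x ≠ y ∧ C = (([x, y, op x y] : List V) : Cycle V)}
  isTriple := by
    rintro _ ⟨x, y, hxy, rfl⟩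
    have h1 : x ≠ op x y := fun h =>
      hxy ((hM.bijective_left x).1 ((hM.idem x).trans h))
    have h2 : y ≠ op x y := fun h =>
      hxy ((hM.bijective_right y).1 (h.symm.trans (hM.idem y).symm))
    exact ⟨by simp [hxy, h1, h2], rfl⟩
  existsUnique_block := by
    intro x y hxy
    refine ⟨_, ⟨⟨x, y, hxy, rfl⟩, _, rfl⟩, ?_⟩
    rintro _ ⟨⟨a, b, -, hab⟩, z, rfl⟩
    -- the block is a rotation of `⟨a, b, a ∘ b⟩`, and each rotation has the same form
    rw [Cycle.coe_eq_coe] at hab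
    obtain ⟨n, hn, h⟩ := List.isRotated_iff_mod.mp hab.symm
    have hn : n = 0 ∨ n = 1 ∨ n = 2 ∨ n = 3 := by
      simp only [List.length_cons, List.length_nil] at hn
      omega
    have hz : z = op x y := by
      rcases hn with rfl | rfl | rfl | rfl <;> simp [List.rotate] at h <;>
        obtain ⟨rfl, rfl, rfl⟩ := h
      · rfl
      · exact (hM.semisymm _ _).symm
      · exact (hM.op_op_left _ _).symm
      · rfl
    rw [hz]

theorem IsMendelsohnQuasigroup.tripleSystem_op {V : Type*} {op : V → V → V}
    (hM : IsMendelsohnQuasigroup op) : hM.tripleSystem.op = op := by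
  funext x y
  rcases eq_or_ne x y with rfl | h
  · rw [MendelsohnTripleSystem.op_self, hM.idem]
  · exact MendelsohnTripleSystem.op_eq_of_mem _ ⟨x, y, h, rfl⟩

theorem isLoeschian_of_quasigroup {Q : Type*} {op : Q → Q → Q} (hQ : Nat.card Q ≠ 0)
    (hM : IsMendelsohnQuasigroup op) (hD : IsDistributiveOp op) : IsLoeschian (Nat.card Q) := by
  obtain ⟨_, _⟩ := Nat.card_ne_zero.mp hQ
  exact .of_even_factorization hQ fun q hq hq2 => hM.even_factorization_card hD hq hq2

theorem factorization_prod_pow_mul_prod_pow {a b : ℕ} {p r : Fin a → ℕ} {q s : Fin b → ℕ}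
    (hp : ∀ i, (p i).Prime) (hq : ∀ j, (q j).Prime)
    (hinj : Function.Injective (Sum.elim p q)) (j : Fin b) :
    ((∏ i, p i ^ r i) * ∏ j, q j ^ s j).factorization (q j) = s j := by
  have hp0 : ∀ i ∈ Finset.univ, p i ^ r i ≠ 0 := fun i _ => pow_ne_zero _ (hp i).ne_zero
  have hq0 : ∀ i ∈ Finset.univ, q i ^ s i ≠ 0 := fun i _ => pow_ne_zero _ (hq i).ne_zero
  rw [Nat.factorization_mul (Finset.prod_ne_zero_iff.mpr hp0) (Finset.prod_ne_zero_iff.mpr hq0),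
    Nat.factorization_prod hp0, Nat.factorization_prod hq0]
  simp only [(hp _).factorization_pow, (hq _).factorization_pow, Finsupp.add_apply,
    Finsupp.finsetSum_apply]
  rw [Finset.sum_eq_zero, Finset.sum_eq_single j, Finsupp.single_eq_same, zero_add]
  · intro i _ hij
    refine Finsupp.single_eq_of_ne' fun h => hij ?_
    exact Sum.inr_injective (hinj (a₁ := Sum.inr i) (a₂ := Sum.inr j) h)
  · simp
  · intro i _
    refine Finsupp.single_eq_of_ne' fun h => ?_
    exact Sum.inl_ne_inr (hinj (a₁ := Sum.inl i) (a₂ := Sum.inr j) h)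

theorem mainTheorem1 :
    -- necessary condition in terms of the prime factorization
    (∀ (a b : ℕ) (p r : Fin a → ℕ) (q s : Fin b → ℕ) (v : ℕ),
      (∀ i, (p i).Prime) → (∀ j, (q j).Prime) →
      Function.Injective (Sum.elim p q) →
      (∀ i, p i ≡ 1 [MOD 6] ∨ p i = 3) →
      (∀ j, q j ≡ 2 [MOD 3]) →
      v = (∏ i, p i ^ r i) * ∏ j, q j ^ s j →
      (∃ j, Odd (s j)) →
      ¬ ∃ (Q : Type u) (op : Q → Q → Q),
          Nat.card Q = v ∧ IsMendelsohnQuasigroup op ∧ IsDistributiveOp op) ∧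
    -- existence spectrum of distributive Mendelsohn quasigroups
    (∀ v : ℕ, 1 ≤ v →
      ((∃ (Q : Type u) (op : Q → Q → Q),
          Nat.card Q = v ∧ IsMendelsohnQuasigroup op ∧ IsDistributiveOp op) ↔
        IsLoeschian v)) ∧
    -- existence spectrum of distributive Mendelsohn triple systems
    (∀ v : ℕ, 1 ≤ v →
      ((∃ (V : Type u) (M : MendelsohnTripleSystem V),
          Nat.card V = v ∧ IsDistributiveOp M.op) ↔
        IsLoeschian v)) := by
  refine ⟨?_, fun v hv => ⟨?_, ?_⟩, fun v hv => ⟨?_, ?_⟩⟩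
  · rintro a b p r q s v hp hq hinj - hq2 hv ⟨j, hj⟩ ⟨Q, op, hcard, hM, hD⟩
    have hv0 : v ≠ 0 := by
      rw [hv]
      exact mul_ne_zero (Finset.prod_ne_zero_iff.mpr fun i _ => pow_ne_zero _ (hp i).ne_zero)
        (Finset.prod_ne_zero_iff.mpr fun i _ => pow_ne_zero _ (hq i).ne_zero)
    obtain ⟨_, _⟩ := Nat.card_ne_zero.mp (hcard ▸ hv0)
    have he := hM.even_factorization_card hD (hq j) (hq2 j)
    rw [hcard, hv, factorization_prod_pow_mul_prod_pow hp hq hinj] at he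
    exact Nat.not_even_iff_odd.mpr hj he
  · rintro ⟨Q, op, rfl, hM, hD⟩
    exact isLoeschian_of_quasigroup (by omega) hM hD
  · exact fun h => h.exists_quasigroup (by omega)
  · rintro ⟨V, M, rfl, hD⟩
    exact isLoeschian_of_quasigroup (by omega) M.isMendelsohnQuasigroup hD
  · intro h
    obtain ⟨Q, op, hcard, hM, hD⟩ := h.exists_quasigroup (by omega)
    exact ⟨Q, hM.tripleSystem, hcard, by rwa [hM.tripleSystem_op]⟩
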